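/- Let $M$ be a separable $\mathrm{II}_1$ factor, i.e. an infinite-dimensional von Neumann factor with a (necessarily unique) normal faithful tracial state $\tau$ which is separable in the norm $\|x\|_2=\tau(x^*x)^{1/2}$. Assume there exist a non-zero projection $p\in M$ and a von Neumann subalgebra $B\subset pMp$ (with unit $p$) such that $B\subset pMp$ is a rigid inclusion and $B'\cap pMp\subset B$. Then the fundamental group $$\mathcal F(M)=\{\tau(e)/\tau(f)\;:\; e,f\in M \text{ non-zero projections with } eMe\cong fMf\}\subset(0,\infty)$$ is countable. Here an inclusion $B\subset N$ of finite von Neumann algebras is called rigid if, for some normal faithful tracial state $\tau_N$ on $N$, the following holds: for every $\varepsilon>0$ there are a finite set $F\subset N$ and $\delta>0$ such that every completely positive linear map $\phi:N\to N$ with $\phi(1)\le 1$, $\tau_N\circ\phi\le\tau_N$ on positive elements and $\|\phi(x)-x\|_{2}\le\delta$ for all $x\in F$ satisfies $\|\phi(b)-b\|_{2}\le\varepsilon$ for all $b\in B$ with $\|b\|\le1$, where $\|x\|_2=\tau_N(x^*x)^{1/2}$. -/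

import Mathlib

open scoped InnerProductSpace ComplexOrder Matrix

noncomputable section

namespace VonNeumannAlgebra

universe u

variable {H : Type u} [NormedAddCommGroup H] [InnerProductSpace ℂ H] [CompleteSpace H]

/-- The elements of a von Neumann algebra `M`, as a unital complex star algebra. -/
abbrev Elem (M : VonNeumannAlgebra H) : Type u := M.toStarSubalgebra

/-- A linear functional on `M` is normal if it is σ-weakly (ultraweakly) continuous, that is, if it
is of the form `x ↦ ∑ₙ ⟨ηₙ, x ξₙ⟩` with `∑ₙ ‖ξₙ‖² < ∞` and `∑ₙ ‖ηₙ‖² < ∞`. -/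
def IsNormal (M : VonNeumannAlgebra H) (τ : M.Elem →ₗ[ℂ] ℂ) : Prop :=
  ∃ ξ η : ℕ → H, (Summable fun n => ‖ξ n‖ ^ 2) ∧ (Summable fun n => ‖η n‖ ^ 2) ∧
    ∀ x : M.Elem, HasSum (fun n => ⟪η n, (x : H →L[ℂ] H) (ξ n)⟫_ℂ) (τ x)

/-- `τ` is a normal faithful tracial state on `M`. -/
structure IsTracialState (M : VonNeumannAlgebra H) (τ : M.Elem →ₗ[ℂ] ℂ) : Prop where
  map_one : τ 1 = 1
  nonneg : ∀ x : M.Elem, 0 ≤ τ (star x * x)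
  faithful : ∀ x : M.Elem, τ (star x * x) = 0 → x = 0
  tracial : ∀ x y : M.Elem, τ (x * y) = τ (y * x)
  normal : M.IsNormal τ

/-- The Hilbert norm `‖x‖₂ = τ(x* x)^{1/2}` given by a trace. -/
def twoNorm {M : VonNeumannAlgebra H} (τ : M.Elem →ₗ[ℂ] ℂ) (x : M.Elem) : ℝ :=
  Real.sqrt (τ (star x * x)).re

/-- `M` is a factor: the center of `M` consists of the scalars. -/
def IsFactor (M : VonNeumannAlgebra H) : Prop :=
  ∀ x ∈ M, x ∈ M.commutant → ∃ c : ℂ, x = c • (1 : H →L[ℂ] H)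

/-- `M` is a II₁ factor: an infinite-dimensional factor with a normal faithful tracial state
(which is then unique). -/
structure IsII1Factor (M : VonNeumannAlgebra H) : Prop where
  factor : M.IsFactor
  infinite_dim : ¬ FiniteDimensional ℂ M.Elem
  exists_trace : ∃ τ : M.Elem →ₗ[ℂ] ℂ, M.IsTracialState τ

/-- A finite von Neumann algebra is separable if, for a normal faithful tracial state, it is
separable in the corresponding Hilbert norm. -/
def IsSeparableTracial (M : VonNeumannAlgebra H) : Prop :=
  ∃ τ : M.Elem →ₗ[ℂ] ℂ, M.IsTracialState τ ∧
    ∃ S : Set M.Elem, S.Countable ∧ ∀ x : M.Elem, ∀ ε > 0, ∃ s ∈ S, twoNorm τ (x - s) < ε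

/-- The (orthogonal) projections belonging to `M`. -/
structure Projection (M : VonNeumannAlgebra H) where
  op : H →L[ℂ] H
  mem : op ∈ M
  isStarProjection : IsStarProjection op

namespace Projection

variable {M : VonNeumannAlgebra H}

/-- A projection as an element of `M`. -/
def elem (p : M.Projection) : M.Elem := ⟨p.op, p.mem⟩

/-- The closed subspace `pH`. -/
abbrev space (p : M.Projection) : Submodule ℂ H := p.op.range

instance (p : M.Projection) : CompleteSpace p.space :=
  (ContinuousLinearMap.IsIdempotentElem.isClosed_range
    p.isStarProjection.isIdempotentElem).completeSpace_coe

/-- The operator on `H` that equals `T` on `pH` and `0` on its orthogonal complement. -/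
def extend (p : M.Projection) (T : p.space →L[ℂ] p.space) : H →L[ℂ] H :=
  p.space.subtypeL ∘L T ∘L p.space.orthogonalProjectionOnto

/-- The compression of `x` to `pH`, that is, `pxp` viewed as an operator on `pH`. -/
def compress (p : M.Projection) (x : H →L[ℂ] H) : p.space →L[ℂ] p.space :=
  p.space.orthogonalProjectionOnto ∘L x ∘L p.space.subtypeL

theorem starProjection_space (p : M.Projection) : p.space.starProjection = p.op := by
  obtain ⟨_, h⟩ := isStarProjection_iff_eq_starProjection_range.mp
    p.isStarProjection
  exact h.symm

theorem extend_mul (p : M.Projection) (S T : p.space →L[ℂ] p.space) :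
    p.extend (S * T) = p.extend S * p.extend T := by
  ext v
  simp [extend]

theorem extend_one (p : M.Projection) : p.extend 1 = p.op := by
  rw [← p.starProjection_space]
  rfl

theorem extend_star (p : M.Projection) (T : p.space →L[ℂ] p.space) :
    p.extend (star T) = star (p.extend T) := by
  simp only [extend, ContinuousLinearMap.star_eq_adjoint, ContinuousLinearMap.adjoint_comp,
    Submodule.adjoint_subtypeL, Submodule.adjoint_orthogonalProjectionOnto,
    ContinuousLinearMap.comp_assoc]

theorem extend_compress (p : M.Projection) (x : H →L[ℂ] H) :
    p.extend (p.compress x) = p.op * x * p.op := by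
  rw [← p.starProjection_space]
  rfl

theorem compress_extend (p : M.Projection) (T : p.space →L[ℂ] p.space) :
    p.compress (p.extend T) = T := by
  ext v
  simp [extend, compress]

end Projection

/-- The corner `pMp`, a von Neumann algebra on `pH`: the operators on `pH` whose extension by `0`
to `H` belongs to `M`. -/
def corner (M : VonNeumannAlgebra H) (p : M.Projection) : VonNeumannAlgebra p.space where
  carrier := {T | p.extend T ∈ M}
  mul_mem' {S T} hS hT := by
    change p.extend (S * T) ∈ M
    rw [p.extend_mul]
    exact mul_mem hS hT
  add_mem' {S T} hS hT := by
    have h : p.extend (S + T) = p.extend S + p.extend T := by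
      ext v
      simp [Projection.extend]
    change p.extend (S + T) ∈ M
    rw [h]
    exact add_mem hS hT
  algebraMap_mem' c := by
    have h : p.extend (algebraMap ℂ _ c) = c • p.op := by
      rw [← p.extend_one]
      ext v
      simp [Projection.extend, Algebra.algebraMap_eq_smul_one]
    change p.extend (algebraMap ℂ _ c) ∈ M
    rw [h]
    exact M.toStarSubalgebra.smul_mem p.mem c
  star_mem' {T} hT := by
    change p.extend (star T) ∈ M
    rw [p.extend_star]
    exact star_mem (S := VonNeumannAlgebra H) hT
  centralizer_centralizer' := by
    refine Set.Subset.antisymm (fun T hT => ?_) Set.subset_centralizer_centralizer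
    change p.extend T ∈ M
    suffices h : p.extend T ∈ M.commutant.commutant by rwa [M.commutant_commutant] at h
    rw [mem_commutant_iff]
    intro y hy
    have hyp : p.op * y = y * p.op := mem_commutant_iff.mp hy _ p.mem
    have hpp : p.op * p.op = p.op := p.isStarProjection.isIdempotentElem
    have hext : ∀ S, p.op * p.extend S = p.extend S := fun S => by
      rw [← p.extend_one, ← p.extend_mul, one_mul]
    have hext' : ∀ S, p.extend S * p.op = p.extend S := fun S => by
      rw [← p.extend_one, ← p.extend_mul, mul_one]
    have hc : p.extend (p.compress y) = y * p.op := by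
      rw [p.extend_compress, hyp, mul_assoc, hpp]
    have hinj : Function.Injective p.extend :=
      Function.LeftInverse.injective p.compress_extend
    have hcomm : p.compress y ∈ Set.centralizer {T | p.extend T ∈ M} := by
      intro S hS
      apply hinj
      rw [p.extend_mul, p.extend_mul, hc, mul_assoc y, hext, ← mul_assoc,
        mem_commutant_iff.mp hy _ hS, mul_assoc, hext']
    have h := congrArg p.extend (hT _ hcomm)
    rw [p.extend_mul, p.extend_mul, hc, mul_assoc y, hext, ← hyp, ← mul_assoc, hext'] at h
    exact h

theorem mem_corner_iff (M : VonNeumannAlgebra H) (p : M.Projection)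
    (T : p.space →L[ℂ] p.space) : T ∈ M.corner p ↔ ∃ x ∈ M, p.compress x = T := by
  constructor
  · intro hT
    exact ⟨p.extend T, hT, p.compress_extend T⟩
  · rintro ⟨x, hx, rfl⟩
    change p.extend (p.compress x) ∈ M
    rw [p.extend_compress]
    exact mul_mem (mul_mem p.mem hx) p.mem

/-- The fundamental group of a II₁ factor: the ratios `τ(p)/τ(q)`, where `τ` is the trace and
`p`, `q` are non-zero projections of `M` such that `pMp` and `qMq` are isomorphic. -/
def fundamentalGroup (M : VonNeumannAlgebra H) : Set ℝ :=
  {t | ∃ τ : M.Elem →ₗ[ℂ] ℂ, M.IsTracialState τ ∧ ∃ p q : M.Projection, p.op ≠ 0 ∧ q.op ≠ 0 ∧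
    Nonempty ((M.corner p).Elem ≃⋆ₐ[ℂ] (M.corner q).Elem) ∧
    t = (τ p.elem).re / (τ q.elem).re}

/-- A linear map `φ : M → M` is completely positive if, for all `n`, its entrywise amplification
to `n × n` matrices over `M` maps positive elements `C* C` to positive elements. -/
def IsCompletelyPositive {M : VonNeumannAlgebra H} (φ : M.Elem →ₗ[ℂ] M.Elem) : Prop :=
  ∀ (n : ℕ) (C : Matrix (Fin n) (Fin n) M.Elem),
    ∃ D : Matrix (Fin n) (Fin n) M.Elem, (Cᴴ * C).map φ = Dᴴ * D

/-- The inclusion `B ⊆ N` is rigid: for some normal faithful tracial state `τ` of `N` and every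
`ε > 0` there are a finite `F ⊆ N` and `δ > 0` such that every subunital, subtracial completely
positive map on `N` which moves the elements of `F` by at most `δ` in `‖·‖₂` moves the elements of
the unit ball of `B` by at most `ε`. Such a map is automatically normal. -/
def IsRigidInclusion (B N : VonNeumannAlgebra H) : Prop :=
  B ≤ N ∧ ∃ τ : N.Elem →ₗ[ℂ] ℂ, N.IsTracialState τ ∧
    ∀ ε > 0, ∃ F : Finset N.Elem, ∃ δ > 0, ∀ φ : N.Elem →ₗ[ℂ] N.Elem,
      IsCompletelyPositive φ →
      (φ 1 : H →L[ℂ] H) ≤ 1 →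
      (∀ x : N.Elem, τ (φ (star x * x)) ≤ τ (star x * x)) →
      (∀ x ∈ F, twoNorm τ (φ x - x) ≤ δ) →
      ∀ b : N.Elem, (b : H →L[ℂ] H) ∈ B → ‖(b : H →L[ℂ] H)‖ ≤ 1 → twoNorm τ (φ b - b) ≤ ε

end VonNeumannAlgebra

end

/-! ### Faithful traces, their Hilbert norms, and fixed points of contractions -/

noncomputable section

open Filter Topology

/-! Write `N = pMp`, with trace `σ`. Each `t` in the fundamental group yields an isomorphism `θ` of
`N` onto a corner of some matrix algebra `Q = M_k(M)` that multiplies traces by a fixed multiple of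
`t` (`exists_embedding_of_mem_fundamentalGroup`). If the group were uncountable, uncountably many
`t` would share the same `k` and a positive lower bound on the scale. The `L²` space of `Q` being
separable, two of them, `θ₁` and `θ₂` with scales `t₁ ≤ t₂`, would then be as close as desired on a
finite set.

Take the finite set that rigidity provides, together with `1`. The map `φ = θ₂⁻¹(p₂ θ₁(·) p₂)`, `p₂
= θ₂(1)`, is completely positive, subunital and, because `t₁ ≤ t₂`, subtracial; it is close to the
identity on the finite set, hence uniformly on the unit ball of `B`. So `θ₁` and `θ₂` are uniformly
close on the unitaries of `B`, and the element of least norm in the closed convex hull of the `θ₁(u)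
θ₂(u)*` is a non-zero `v` with `θ₁(b) v = v θ₂(b)` on `B` (`exists_intertwiner`). Then `v*v = θ₂(y)`
and `vv* = θ₁(z)` with `y, z ∈ B' ∩ N ⊆ B`; intertwining `y` and `z` themselves forces `y = z`, and
`τ(vv*) = τ(v*v)` gives `t₁ = t₂` (`eq_of_exists_intertwiner`).

The construction of `θ` needs uniqueness of the trace and comparison of projections. Both are proved
for a C⋆-algebra with trivial center and a faithful trace satisfying `FaithfulTrace.Complete`, a
property that passes to corners and matrices. Isomorphisms of corners need no normality, since any
two complete traces are proportional (`Complete.apply_mul_apply_one`). -/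

/-- A positive faithful tracial functional on a star algebra. -/
structure FaithfulTrace (A : Type*) [Ring A] [StarRing A] [Algebra ℂ A] where
  /-- The underlying linear functional. -/
  toLin : A →ₗ[ℂ] ℂ
  nonneg' : ∀ x, 0 ≤ toLin (star x * x)
  faithful' : ∀ x, toLin (star x * x) = 0 → x = 0
  tracial' : ∀ x y, toLin (x * y) = toLin (y * x)

namespace FaithfulTrace

section Basic

variable {A : Type*} [Ring A] [StarRing A] [Algebra ℂ A]

instance : CoeFun (FaithfulTrace A) fun _ => A → ℂ := ⟨fun τ => τ.toLin⟩

variable (τ : FaithfulTrace A)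

theorem nonneg (x : A) : 0 ≤ τ (star x * x) := τ.nonneg' x

theorem mul_comm (x y : A) : τ (x * y) = τ (y * x) := τ.tracial' x y

variable [StarModule ℂ A]

theorem apply_star (z : A) : τ (star z) = star (τ z) := by
  -- The values of `τ` at `(1 + z)*(1 + z)`, `z*z` and `1` are real. Using this for `z` and for `i
  -- z` gives both parts of the identity.
  have key : ∀ z : A, (τ z).im + (τ (star z)).im = 0 := by
    intro z
    have h1 := (Complex.nonneg_iff.mp (τ.nonneg (1 + z))).2
    have h2 := (Complex.nonneg_iff.mp (τ.nonneg z)).2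
    have h3 := (Complex.nonneg_iff.mp (τ.nonneg 1)).2
    have e : star (1 + z) * (1 + z) = star 1 * 1 + z + star z + star z * z := by
      simp only [star_add, star_one]; noncomm_ring
    rw [e] at h1
    simp only [map_add, Complex.add_im] at h1
    linarith
  have h1 := key z
  have h2 := key (Complex.I • z)
  simp only [star_smul, map_smul, smul_eq_mul, Complex.mul_im, Complex.star_def, Complex.conj_I,
    Complex.I_re, Complex.I_im, Complex.neg_re, Complex.neg_im] at h2
  apply Complex.ext
  · simp only [Complex.star_def, Complex.conj_re]; linarith
  · simp only [Complex.star_def, Complex.conj_im]; linarith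

/-- The algebra with the inner product given by a faithful trace. -/
def L2 (_ : FaithfulTrace A) : Type _ := A

instance : AddCommGroup τ.L2 := inferInstanceAs (AddCommGroup A)

instance : Module ℂ τ.L2 := inferInstanceAs (Module ℂ A)

/-- The identity map of the algebra into its inner product space. -/
def toL2 : A ≃ₗ[ℂ] τ.L2 := LinearEquiv.refl ℂ A

/-- The inner product structure given by a faithful trace. -/
@[reducible]
def core : InnerProductSpace.Core ℂ τ.L2 where
  inner x y := τ (star (τ.toL2.symm x) * τ.toL2.symm y)
  conj_inner_symm x y := by
    rw [← Complex.star_def, ← τ.apply_star]; simp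
  re_inner_nonneg x := (Complex.nonneg_iff.mp (τ.nonneg _)).1
  add_left x y z := by simp [add_mul]
  smul_left x y c := by simp [star_smul]
  definite x h := by
    have := τ.faithful' _ h
    simpa using this

instance : NormedAddCommGroup τ.L2 := τ.core.toNormedAddCommGroup

instance : InnerProductSpace ℂ τ.L2 := InnerProductSpace.ofCore τ.core.toCore

theorem inner_toL2 (x y : A) : ⟪τ.toL2 x, τ.toL2 y⟫_ℂ = τ (star x * y) := rfl

theorem norm_toL2_sq (x : A) : ‖τ.toL2 x‖ ^ 2 = (τ (star x * x)).re := by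
  rw [← inner_toL2, ← inner_self_eq_norm_sq (𝕜 := ℂ)]; rfl

theorem apply_star_mul_self (x : A) : τ (star x * x) = (‖τ.toL2 x‖ ^ 2 : ℝ) := by
  rw [norm_toL2_sq]
  exact Complex.ext rfl (Complex.nonneg_iff.mp (τ.nonneg x)).2.symm

theorem norm_toL2_star (x : A) : ‖τ.toL2 (star x)‖ = ‖τ.toL2 x‖ := by
  rw [← sq_eq_sq₀ (norm_nonneg _) (norm_nonneg _), norm_toL2_sq, norm_toL2_sq, star_star,
    τ.mul_comm]

/-- Multiplication by a partial isometry does not increase the norm. -/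
theorem norm_toL2_mul_le_of_proj {x u p : A} (hu : u * star u = p) (hp : star p * p = p) :
    ‖τ.toL2 (x * u)‖ ≤ ‖τ.toL2 x‖ := by
  -- The single equation `p* p = p` encodes both self-adjointness and idempotence.
  have hps : star p = p := by rw [← hp, star_mul, star_star, hp]
  have hpp : p * p = p := by rw [hps] at hp; exact hp
  have h1 : ‖τ.toL2 (x * u)‖ ^ 2 = ‖τ.toL2 (x * p)‖ ^ 2 := by
    rw [norm_toL2_sq, norm_toL2_sq, star_mul, mul_assoc, τ.mul_comm, star_mul, mul_assoc, hps,
      mul_assoc, mul_assoc, hu, τ.mul_comm p, mul_assoc, mul_assoc, hpp]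
  -- Pythagoras for `x = xp + x(1 - p)`.
  have h2 : ‖τ.toL2 x‖ ^ 2 = ‖τ.toL2 (x * p)‖ ^ 2 + ‖τ.toL2 (x * (1 - p))‖ ^ 2 := by
    have h3 : ∀ q : A, star q = q → q * q = q →
        ‖τ.toL2 (x * q)‖ ^ 2 = (τ (star x * x * q)).re := fun q hq hqq => by
      rw [norm_toL2_sq, star_mul, hq, τ.mul_comm, mul_assoc, ← mul_assoc q, hqq, ← mul_assoc,
        τ.mul_comm, mul_assoc]
    rw [h3 p hps hpp, h3 (1 - p) (by simp [hps]) (by simp [mul_sub, sub_mul, hpp]), norm_toL2_sq,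
      ← Complex.add_re, ← map_add, ← mul_add, add_sub_cancel, mul_one]
  rw [← pow_le_pow_iff_left₀ (norm_nonneg _) (norm_nonneg _) two_ne_zero]
  nlinarith [sq_nonneg ‖τ.toL2 (x * (1 - p))‖]

theorem norm_toL2_mul_le_of_proj_left {x u p : A} (hu : star u * u = p) (hp : star p * p = p) :
    ‖τ.toL2 (u * x)‖ ≤ ‖τ.toL2 x‖ := by
  rw [← norm_toL2_star, star_mul, ← norm_toL2_star _ x]
  exact τ.norm_toL2_mul_le_of_proj (p := p) (by rwa [star_star]) hp

end Basic

section CStar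

variable {A : Type*} [CStarAlgebra A] [PartialOrder A] [StarOrderedRing A] (τ : FaithfulTrace A)

theorem apply_nonneg {x : A} (hx : 0 ≤ x) : 0 ≤ τ x := by
  obtain ⟨d, rfl⟩ := CStarAlgebra.nonneg_iff_eq_star_mul_self.mp hx
  exact τ.nonneg d

theorem re_apply_nonneg {x : A} (hx : 0 ≤ x) : 0 ≤ (τ x).re :=
  (Complex.nonneg_iff.mp (τ.apply_nonneg hx)).1

theorem apply_mono {x y : A} (h : x ≤ y) : (τ x).re ≤ (τ y).re := by
  have := τ.re_apply_nonneg (sub_nonneg.mpr h)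
  rw [map_sub, Complex.sub_re] at this
  linarith

theorem eq_zero_of_nonneg {x : A} (hx : 0 ≤ x) (h : (τ x).re = 0) : x = 0 := by
  obtain ⟨d, rfl⟩ := CStarAlgebra.nonneg_iff_eq_star_mul_self.mp hx
  rw [← norm_toL2_sq] at h
  have : d = 0 := by simpa using h
  simp [this]

theorem norm_toL2_mul_le (a x : A) : ‖τ.toL2 (a * x)‖ ≤ ‖a‖ * ‖τ.toL2 x‖ := by
  rw [← pow_le_pow_iff_left₀ (norm_nonneg _) (by positivity) two_ne_zero, mul_pow, norm_toL2_sq,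
    norm_toL2_sq]
  have h := star_left_conjugate_le_conjugate
    (CStarAlgebra.star_mul_le_algebraMap_norm_sq (a := a)) x
  have h2 := τ.apply_mono h
  have e1 : star x * (star a * a) * x = star (a * x) * (a * x) := by
    simp only [star_mul, mul_assoc]
  have e2 : star x * (algebraMap ℝ A (‖a‖ ^ 2)) * x = ((‖a‖ ^ 2 : ℝ) : ℂ) • (star x * x) := by
    rw [Algebra.algebraMap_eq_smul_one, Complex.coe_smul]; simp
  rw [e1, e2, map_smul, smul_eq_mul, Complex.re_ofReal_mul] at h2
  exact h2

theorem norm_toL2_mul_le' (x a : A) : ‖τ.toL2 (x * a)‖ ≤ ‖τ.toL2 x‖ * ‖a‖ := by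
  rw [← norm_toL2_star, star_mul, ← norm_toL2_star _ x, _root_.mul_comm, ← norm_star a]
  exact τ.norm_toL2_mul_le _ _

theorem norm_toL2_le (x : A) : ‖τ.toL2 x‖ ≤ ‖x‖ * ‖τ.toL2 1‖ := by
  simpa using τ.norm_toL2_mul_le x 1

/-- Positivity is detected by a faithful trace. -/
theorem nonneg_of_forall {z : A} (hz : IsSelfAdjoint z)
    (h : ∀ a, 0 ≤ (τ (star a * z * a)).re) : 0 ≤ z := by
  have hn : 0 ≤ z⁻ := CFC.negPart_nonneg z
  have hsa : star z⁻ = z⁻ := hn.isSelfAdjoint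
  -- Testing against the negative part itself gives `-τ((z⁻)³) ≥ 0`, so `(z⁻)³ = 0` by faithfulness.
  have h1 := h z⁻
  have e : star z⁻ * z * z⁻ = - (star z⁻ * z⁻ * z⁻) := by
    have hz' := CFC.posPart_sub_negPart z hz
    calc star z⁻ * z * z⁻ = star z⁻ * (z⁺ - z⁻) * z⁻ := by rw [hz']
      _ = _ := by rw [mul_sub, sub_mul, hsa, CFC.negPart_mul_posPart]; simp
  rw [e, map_neg, Complex.neg_re] at h1
  have h3 : 0 ≤ star z⁻ * z⁻ * z⁻ := by
    rw [hsa]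
    have := star_left_conjugate_nonneg hn z⁻
    rwa [hsa] at this
  have h4 := τ.eq_zero_of_nonneg h3 (le_antisymm (by linarith) (τ.re_apply_nonneg h3))
  have h5 : z⁻ = 0 := by
    obtain ⟨s, hs, hs'⟩ : ∃ s : A, star s = s ∧ s * s = z⁻ :=
      ⟨CFC.sqrt z⁻, (CFC.sqrt_nonneg z⁻).isSelfAdjoint, CFC.sqrt_mul_sqrt_self _ hn⟩
    rw [hsa] at h4
    have h6 : star (z⁻ * s) * (z⁻ * s) = 0 := by
      rw [star_mul, hsa, hs]
      calc s * z⁻ * (z⁻ * s) = s * (s * s) * (s * s * s) := by rw [hs']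
        _ = (s * s) * (s * s) * (s * s) := by noncomm_ring
        _ = 0 := by rw [hs', h4]
    have h7 : z⁻ * s = 0 := CStarRing.star_mul_self_eq_zero_iff _ |>.mp h6
    have h8 : star z⁻ * z⁻ = 0 := by
      rw [hsa]; nth_rw 2 [← hs']; rw [← mul_assoc, h7, zero_mul]
    exact CStarRing.star_mul_self_eq_zero_iff _ |>.mp h8
  rw [← CFC.posPart_sub_negPart z hz, h5, sub_zero]
  exact CFC.posPart_nonneg z

/-- Norm-bounded sequences which are Cauchy in the trace norm converge in the trace norm. -/
def Complete : Prop :=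
  ∀ x : ℕ → A, (∃ C, ∀ n, ‖x n‖ ≤ C) → CauchySeq (fun n => τ.toL2 (x n)) →
    ∃ y, Tendsto (fun n => τ.toL2 (x n)) atTop (𝓝 (τ.toL2 y))

end CStar

end FaithfulTrace

/-- A convex set whose Cauchy sequences converge has in its closure a common fixed point of any
family of linear contractions that preserve it. -/
theorem exists_fixed_mem_closure {E ι : Type*} [NormedAddCommGroup E] [InnerProductSpace ℂ E]
    {K : Set E} (hne : K.Nonempty) (hK : Convex ℝ K)
    (hc : ∀ x : ℕ → E, (∀ n, x n ∈ K) → CauchySeq x → ∃ y, Tendsto x atTop (𝓝 y))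
    (ρ : ι → E →ₗ[ℂ] E) (hρ : ∀ i x, ‖ρ i x‖ ≤ ‖x‖) (hmap : ∀ i, ∀ x ∈ K, ρ i x ∈ K) :
    ∃ y ∈ closure K, ∀ i, ρ i y = y := by
  let _ : InnerProductSpace ℝ E := InnerProductSpace.rclikeToReal ℂ E
  -- The ambient space need not be complete. A Cauchy sequence in the closure is shadowed by one in
  -- `K`, with error `1/(n+1)`, to which `hc` applies.
  have hcs : CompleteSpace (closure K) := by
    refine Metric.complete_of_cauchySeq_tendsto fun u hu => ?_
    have hu' : CauchySeq fun n => (u n : E) := hu.map uniformContinuous_subtype_val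
    choose x hxK hx using fun n => Metric.mem_closure_iff.mp (u n).2 (1 / ((n : ℝ) + 1))
      (by positivity)
    have hd : Tendsto (fun n => x n - u n) atTop (𝓝 0) := by
      refine squeeze_zero_norm (fun n => ?_) tendsto_one_div_add_atTop_nhds_zero_nat
      rw [← dist_eq_norm, dist_comm]
      exact (hx n).le
    obtain ⟨y, hy⟩ := hc x hxK (by
      convert hu'.add hd.cauchySeq using 1; ext n; simp)
    have hy2 : Tendsto (fun n => (u n : E)) atTop (𝓝 y) := by simpa using hy.sub hd
    exact ⟨⟨y, mem_closure_of_tendsto hy (Eventually.of_forall hxK)⟩, tendsto_subtype_rng.mpr hy2⟩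
  have hcomplete : IsComplete (closure K) := completeSpace_coe_iff_isComplete.mp hcs
  -- The fixed point is the element `y` of least norm: minimality gives `⟨y, ρy⟩ ≥ ‖y‖²`, whence
  -- `‖ρy - y‖² ≤ ‖ρy‖² - ‖y‖² ≤ 0`.
  obtain ⟨y, hy, hmin⟩ := exists_norm_eq_iInf_of_complete_convex hne.closure hcomplete
    hK.closure 0
  rw [norm_eq_iInf_iff_real_inner_le_zero hK.closure hy] at hmin
  refine ⟨y, hy, fun i => ?_⟩
  have hcont : Continuous (ρ i) :=
    (LinearMap.mkContinuous (ρ i) 1 (by simpa using hρ i)).continuous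
  have hw : ρ i y ∈ closure K := map_mem_closure hcont hy (hmap i)
  have h1 := hmin _ hw
  rw [zero_sub, inner_neg_left, inner_sub_right, real_inner_self_eq_norm_sq] at h1
  have h2 := norm_sub_sq_real (ρ i y) y
  rw [real_inner_comm] at h2
  have h3 := hρ i y
  have h4 : ‖ρ i y - y‖ ^ 2 ≤ 0 := by nlinarith [norm_nonneg (ρ i y), norm_nonneg y]
  have h5 : ‖ρ i y - y‖ = 0 := by
    nlinarith [norm_nonneg (ρ i y - y), sq_nonneg ‖ρ i y - y‖]
  exact sub_eq_zero.mp (norm_eq_zero.mp h5)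

end

/-! ### Dixmier averaging and uniqueness of the trace -/

noncomputable section

open Filter Topology

/-- The center consists of the scalars. -/
def HasTrivialCenter (A : Type*) [Ring A] [Algebra ℂ A] : Prop :=
  ∀ z : A, (∀ x, z * x = x * z) → ∃ c : ℂ, z = c • (1 : A)

section Transform

variable {A : Type*} [CStarAlgebra A] [PartialOrder A] [StarOrderedRing A]

/-- The transform `x / (1 + x)` of a positive element. -/
def boundedTransform (g : A) : A := cfcₙ (fun x : ℝ => 1 - (1 + x)⁻¹) g

/-- Operator monotonicity of `x/(1+x)`. Increasing sums with no norm bound become increasing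
sequences below `1`, to which completeness on bounded sets applies. -/
theorem boundedTransform_mono {a b : A} (ha : 0 ≤ a) (hab : a ≤ b) :
    boundedTransform a ≤ boundedTransform b :=
  CFC.monotoneOn_one_sub_one_add_inv_real ha (ha.trans hab) hab

theorem boundedTransform_eq {g : A} (hg : 0 ≤ g) :
    boundedTransform g = cfc (fun x : ℝ => 1 - (1 + x)⁻¹) g ∧
      ContinuousOn (fun x : ℝ => 1 - (1 + x)⁻¹) (spectrum ℝ g) := by
  have hc : ∀ s : Set ℝ, (∀ x ∈ s, 0 ≤ x) → ContinuousOn (fun x : ℝ => 1 - (1 + x)⁻¹) s :=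
    fun s hs => by
      refine continuousOn_const.sub (ContinuousOn.inv₀ (by fun_prop) fun x hx => ?_)
      have := hs x hx
      positivity
  have h1 := hc _ fun x hx => spectrum_nonneg_of_nonneg hg hx
  refine ⟨?_, h1⟩
  refine cfcₙ_eq_cfc (hf := ?_)
  exact hc _ fun x hx => quasispectrum_nonneg_of_nonneg _ hg _ hx

theorem boundedTransform_nonneg {g : A} (hg : 0 ≤ g) : 0 ≤ boundedTransform g := by
  rw [(boundedTransform_eq hg).1]
  refine cfc_nonneg fun x hx => ?_
  have hx0 := spectrum_nonneg_of_nonneg hg hx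
  have : (1 + x)⁻¹ ≤ 1 := inv_le_one_of_one_le₀ (by linarith)
  linarith

theorem boundedTransform_le_one {g : A} (hg : 0 ≤ g) : boundedTransform g ≤ 1 := by
  rw [(boundedTransform_eq hg).1]
  refine cfc_le_one _ _ fun x hx => ?_
  have hx0 := spectrum_nonneg_of_nonneg hg hx
  have : 0 ≤ (1 + x)⁻¹ := by positivity
  linarith

theorem boundedTransform_le_self {g : A} (hg : 0 ≤ g) : boundedTransform g ≤ g := by
  rw [(boundedTransform_eq hg).1]
  conv_rhs => rw [← cfc_id' ℝ g]
  refine cfc_mono (fun x hx => ?_) (boundedTransform_eq hg).2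
  have hx0 := spectrum_nonneg_of_nonneg hg hx
  have h1 : (1 + x)⁻¹ * (1 + x) = 1 := inv_mul_cancel₀ (by positivity)
  have h2 : 0 ≤ (1 + x)⁻¹ := by positivity
  have h3 : (1 + x)⁻¹ ≤ 1 := inv_le_one_of_one_le₀ (by linarith)
  nlinarith

theorem le_smul_boundedTransform {g : A} (hg : 0 ≤ g) {C : ℝ} (hC : ‖g‖ ≤ C) :
    g ≤ (1 + C) • boundedTransform g := by
  rcases subsingleton_or_nontrivial A with h | h
  · exact (Subsingleton.elim _ _).le
  rw [(boundedTransform_eq hg).1, ← cfc_smul _ _ _ (boundedTransform_eq hg).2]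
  conv_lhs => rw [← cfc_id' ℝ g]
  refine cfc_mono (fun x hx => ?_) (by fun_prop) ((boundedTransform_eq hg).2.const_smul (1 + C))
  have hx0 := spectrum_nonneg_of_nonneg hg hx
  have hx1 : x ≤ C := (le_abs_self x).trans ((spectrum.norm_le_norm_of_mem hx).trans hC)
  have h1 : (1 + x)⁻¹ * (1 + x) = 1 := inv_mul_cancel₀ (by positivity)
  have h2 : 0 ≤ (1 + x)⁻¹ := by positivity
  have h3 : 1 - (1 + x)⁻¹ = x * (1 + x)⁻¹ := by linarith
  simp only [smul_eq_mul]
  rw [h3]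
  calc x = x * (1 + x)⁻¹ * (1 + x) := by rw [mul_assoc, h1, mul_one]
    _ ≤ x * (1 + x)⁻¹ * (1 + C) := by gcongr
    _ = _ := by ring

theorem mul_self_le_of_le_one {d : A} (h0 : 0 ≤ d) (h1 : d ≤ 1) : d * d ≤ d := by
  simpa [sq] using CStarAlgebra.pow_antitone h0 h1 one_le_two

end Transform

namespace FaithfulTrace

section Limits

variable {A : Type*} [Ring A] [StarRing A] [Algebra ℂ A] [StarModule ℂ A] (τ : FaithfulTrace A)

theorem tendsto_star {x : ℕ → A} {y : A} (h : Tendsto (fun n => τ.toL2 (x n)) atTop (𝓝 (τ.toL2 y))) :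
    Tendsto (fun n => τ.toL2 (star (x n))) atTop (𝓝 (τ.toL2 (star y))) := by
  rw [tendsto_iff_norm_sub_tendsto_zero] at h ⊢
  simpa only [← map_sub, ← star_sub, norm_toL2_star] using h

theorem tendsto_apply_mul (a : A) {x : ℕ → A} {y : A}
    (h : Tendsto (fun n => τ.toL2 (x n)) atTop (𝓝 (τ.toL2 y))) :
    Tendsto (fun n => τ (a * x n)) atTop (𝓝 (τ (a * y))) := by
  have := (tendsto_const_nhds (x := τ.toL2 (star a))).inner (𝕜 := ℂ) h
  simpa only [inner_toL2, star_star] using this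

theorem tendsto_apply {x : ℕ → A} {y : A}
    (h : Tendsto (fun n => τ.toL2 (x n)) atTop (𝓝 (τ.toL2 y))) :
    Tendsto (fun n => τ (x n)) atTop (𝓝 (τ y)) := by
  simpa using τ.tendsto_apply_mul 1 h

theorem tendsto_apply_re {x : ℕ → A} {y : A}
    (h : Tendsto (fun n => τ.toL2 (x n)) atTop (𝓝 (τ.toL2 y))) :
    Tendsto (fun n => (τ (x n)).re) atTop (𝓝 (τ y).re) :=
  (Complex.continuous_re.tendsto _).comp (τ.tendsto_apply h)

end Limits

variable {A : Type*} [CStarAlgebra A] [PartialOrder A] [StarOrderedRing A] (τ : FaithfulTrace A)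

theorem tendsto_mul_left (a : A) {x : ℕ → A} {y : A}
    (h : Tendsto (fun n => τ.toL2 (x n)) atTop (𝓝 (τ.toL2 y))) :
    Tendsto (fun n => τ.toL2 (a * x n)) atTop (𝓝 (τ.toL2 (a * y))) := by
  rw [tendsto_iff_norm_sub_tendsto_zero] at h ⊢
  refine squeeze_zero (fun _ => norm_nonneg _) (fun n => ?_) (by simpa using h.const_mul ‖a‖)
  rw [← map_sub, ← mul_sub, ← map_sub]
  exact τ.norm_toL2_mul_le _ _

theorem tendsto_mul_right (a : A) {x : ℕ → A} {y : A}
    (h : Tendsto (fun n => τ.toL2 (x n)) atTop (𝓝 (τ.toL2 y))) :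
    Tendsto (fun n => τ.toL2 (x n * a)) atTop (𝓝 (τ.toL2 (y * a))) := by
  simpa using τ.tendsto_star (τ.tendsto_mul_left (star a) (τ.tendsto_star h))

theorem nonneg_of_tendsto {x : ℕ → A} {y : A}
    (h : Tendsto (fun n => τ.toL2 (x n)) atTop (𝓝 (τ.toL2 y))) (hx : ∀ᶠ n in atTop, 0 ≤ x n) :
    0 ≤ y := by
  refine τ.nonneg_of_forall ?_ fun a => ?_
  · refine τ.toL2.injective (tendsto_nhds_unique (τ.tendsto_star h) (h.congr' ?_))
    filter_upwards [hx] with n hn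
    rw [hn.isSelfAdjoint.star_eq]
  · refine ge_of_tendsto (τ.tendsto_apply_re (τ.tendsto_mul_right a (τ.tendsto_mul_left (star a) h)))
      ?_
    filter_upwards [hx] with n hn
    exact τ.re_apply_nonneg (star_left_conjugate_nonneg hn a)

theorem le_of_tendsto_of_tendsto {x x' : ℕ → A} {y y' : A}
    (h : Tendsto (fun n => τ.toL2 (x n)) atTop (𝓝 (τ.toL2 y)))
    (h' : Tendsto (fun n => τ.toL2 (x' n)) atTop (𝓝 (τ.toL2 y')))
    (hx : ∀ᶠ n in atTop, x n ≤ x' n) : y ≤ y' := by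
  rw [← sub_nonneg]
  refine τ.nonneg_of_tendsto (x := fun n => x' n - x n) (by simpa using h'.sub h) ?_
  filter_upwards [hx] with n hn
  exact sub_nonneg.mpr hn

theorem norm_toL2_sq_le_of_le_one {d : A} (h0 : 0 ≤ d) (h1 : d ≤ 1) :
    ‖τ.toL2 d‖ ^ 2 ≤ (τ d).re := by
  rw [norm_toL2_sq, h0.isSelfAdjoint.star_eq]
  exact τ.apply_mono (mul_self_le_of_le_one h0 h1)

/-- The convex hull of the unitary conjugates of an element. -/
def conjHull (x : A) : Set A :=
  convexHull ℝ (Set.range fun u : unitary A => (u : A) * x * star (u : A))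

omit [PartialOrder A] [StarOrderedRing A] in
theorem norm_le_of_mem_conjHull {x y : A} (hy : y ∈ conjHull x) : ‖y‖ ≤ ‖x‖ := by
  have : conjHull x ⊆ Metric.closedBall 0 ‖x‖ := by
    refine convexHull_min ?_ (convex_closedBall _ _)
    rintro _ ⟨u, rfl⟩
    simp [← Unitary.coe_star]
  simpa using this hy

omit [PartialOrder A] [StarOrderedRing A] in
theorem apply_eq_of_mem_conjHull {x y : A} (hy : y ∈ conjHull x) : τ y = τ x := by
  have : conjHull x ⊆ {y | τ y = τ x} := by
    refine convexHull_min ?_ ?_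
    · rintro _ ⟨u, rfl⟩
      change τ _ = _
      rw [τ.mul_comm, ← mul_assoc]; simp
    · intro a ha b hb s t _ _ hst
      change τ _ = _
      rw [← Complex.coe_smul, ← Complex.coe_smul, map_add, map_smul, map_smul, ha, hb, ← add_smul,
        ← Complex.ofReal_add, hst]
      simp
  exact this hy

variable {τ}

/-- A difference `d` of two terms satisfies `0 ≤ d ≤ 1`, so `d² ≤ d` and `‖d‖₂² ≤ τ(d)`; the traces
form a bounded monotone sequence. -/
theorem Complete.exists_tendsto_of_monotone (hτ : τ.Complete) {h : ℕ → A} (hm : Monotone h)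
    (h0 : ∀ n, 0 ≤ h n) (h1 : ∀ n, h n ≤ 1) :
    ∃ y, Tendsto (fun n => τ.toL2 (h n)) atTop (𝓝 (τ.toL2 y)) := by
  refine hτ h ⟨1, fun n => (CStarAlgebra.norm_le_one_iff_of_nonneg _ (h0 n)).mpr (h1 n)⟩ ?_
  have hr : Monotone fun n => (τ (h n)).re := fun m n hmn => τ.apply_mono (hm hmn)
  have hcau : CauchySeq fun n => (τ (h n)).re :=
    (tendsto_atTop_ciSup hr ⟨(τ 1).re, by rintro _ ⟨n, rfl⟩; exact τ.apply_mono (h1 n)⟩).cauchySeq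
  have key : ∀ m n, m ≤ n → ‖τ.toL2 (h n) - τ.toL2 (h m)‖ ^ 2 ≤ (τ (h n)).re - (τ (h m)).re := by
    intro m n hmn
    rw [← map_sub, ← Complex.sub_re, ← map_sub]
    exact τ.norm_toL2_sq_le_of_le_one (sub_nonneg.mpr (hm hmn))
      ((sub_le_self _ (h0 m)).trans (h1 n))
  rw [Metric.cauchySeq_iff'] at hcau ⊢
  intro ε hε
  obtain ⟨N, hN⟩ := hcau (ε ^ 2) (by positivity)
  refine ⟨N, fun n hn => ?_⟩
  have h2 := hN n hn
  rw [Real.dist_eq] at h2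
  rw [dist_eq_norm]
  exact lt_of_pow_lt_pow_left₀ 2 hε.le
    ((key N n hn).trans_lt ((le_abs_self _).trans_lt h2))

theorem Complete.exists_tendsto_of_antitone (hτ : τ.Complete) {h : ℕ → A} (hm : Antitone h)
    (h0 : ∀ n, 0 ≤ h n) (h1 : ∀ n, h n ≤ 1) :
    ∃ y, Tendsto (fun n => τ.toL2 (h n)) atTop (𝓝 (τ.toL2 y)) := by
  obtain ⟨y, hy⟩ := hτ.exists_tendsto_of_monotone (h := fun n => 1 - h n)
    (fun m n hmn => sub_le_sub_left (hm hmn) 1) (fun n => sub_nonneg.mpr (h1 n))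
    (fun n => sub_le_self _ (h0 n))
  refine ⟨1 - y, ?_⟩
  simpa using (tendsto_const_nhds (x := τ.toL2 1)).sub hy

/-- Bounded positive sequences whose `τ`-values are summable have `φ`-values that are not bounded
below. -/
theorem Complete.not_forall_le (hτ : τ.Complete) {φ : FaithfulTrace A} (hφ : φ.Complete)
    {y : ℕ → A} (hy0 : ∀ n, 0 ≤ y n) {C : ℝ} (hyC : ∀ n, ‖y n‖ ≤ C)
    (hyτ : ∀ n, (τ (y n)).re ≤ (1 / 2) ^ n) {ε : ℝ} (hε : 0 < ε) : ¬ ∀ n, ε ≤ (φ (y n)).re := by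
  intro hφy
  -- A Borel–Cantelli argument. The transforms of the tails `∑_{k ≥ n} y k` have a decreasing
  -- sequence of limits `h n` with `τ(h n) ≤ 2·2⁻ⁿ`, yet `h n` dominates the transform of `y n`.
  let g : ℕ → ℕ → A := fun n m => ∑ k ∈ Finset.Ico n m, y k
  have hg0 : ∀ n m, 0 ≤ g n m := fun n m => Finset.sum_nonneg fun k _ => hy0 k
  have hgm : ∀ n n' m m', n' ≤ n → m ≤ m' → g n m ≤ g n' m' := fun n n' m m' hn hm =>
    Finset.sum_le_sum_of_subset_of_nonneg (Finset.Ico_subset_Ico hn hm) fun k _ _ => hy0 k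
  have hgτ : ∀ n m, (τ (g n m)).re ≤ 2 * (1 / 2) ^ n := by
    intro n m
    simp only [g, map_sum, Complex.re_sum]
    refine (Finset.sum_le_sum fun k _ => hyτ k).trans ?_
    rcases le_total n m with hnm | hnm
    · rw [geom_sum_Ico (by norm_num) hnm]
      have : (0 : ℝ) ≤ (1 / 2) ^ m := by positivity
      linarith [show ((1 / 2 : ℝ) ^ m - (1 / 2) ^ n) / (1 / 2 - 1) =
        2 * ((1 / 2) ^ n - (1 / 2) ^ m) by ring]
    · rw [Finset.Ico_eq_empty_of_le hnm, Finset.sum_empty]; positivity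
  choose h hh using fun n => hτ.exists_tendsto_of_monotone
    (h := fun m => boundedTransform (g n m))
    (fun m m' hm => boundedTransform_mono (hg0 n m) (hgm n n m m' le_rfl hm))
    (fun m => boundedTransform_nonneg (hg0 n m)) (fun m => boundedTransform_le_one (hg0 n m))
  have hh0 : ∀ n, 0 ≤ h n := fun n => τ.nonneg_of_tendsto (hh n)
    (Eventually.of_forall fun m => boundedTransform_nonneg (hg0 n m))
  have hh1 : ∀ n, h n ≤ 1 := fun n => τ.le_of_tendsto_of_tendsto (hh n) tendsto_const_nhds
    (Eventually.of_forall fun m => boundedTransform_le_one (hg0 n m))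
  have hanti : Antitone h := antitone_nat_of_succ_le fun n =>
    τ.le_of_tendsto_of_tendsto (hh (n + 1)) (hh n) (Eventually.of_forall fun m =>
      boundedTransform_mono (hg0 _ m) (hgm _ _ _ _ (Nat.le_succ n) le_rfl))
  have hhτ : ∀ n, (τ (h n)).re ≤ 2 * (1 / 2) ^ n := fun n =>
    le_of_tendsto (τ.tendsto_apply_re (hh n)) (Eventually.of_forall fun m =>
      (τ.apply_mono (boundedTransform_le_self (hg0 n m))).trans (hgτ n m))
  have hhy : ∀ n, boundedTransform (y n) ≤ h n := fun n =>
    τ.le_of_tendsto_of_tendsto tendsto_const_nhds (hh n) <| by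
      filter_upwards [eventually_ge_atTop (n + 1)] with m hm
      refine boundedTransform_mono (hy0 n) ?_
      have := hgm n n (n + 1) m le_rfl hm
      simpa [g] using this
  -- The limit is taken for `φ`, but the inequalities `0 ≤ l ≤ h n` do not depend on the trace, so
  -- `τ` can be used to see that `l = 0`.
  obtain ⟨l, hl⟩ := hφ.exists_tendsto_of_antitone hanti hh0 hh1
  have hl0 : 0 ≤ l := φ.nonneg_of_tendsto hl (Eventually.of_forall hh0)
  have hlh : ∀ n, l ≤ h n := fun n => φ.le_of_tendsto_of_tendsto hl tendsto_const_nhds <| by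
    filter_upwards [eventually_ge_atTop n] with m hm using hanti hm
  have hlz : l = 0 := by
    refine τ.eq_zero_of_nonneg hl0 (le_antisymm ?_ (τ.re_apply_nonneg hl0))
    have ht : Tendsto (fun n : ℕ => 2 * (1 / 2 : ℝ) ^ n) atTop (𝓝 0) := by
      simpa using (tendsto_pow_atTop_nhds_zero_of_lt_one (r := (1 / 2 : ℝ)) (by norm_num)
        (by norm_num)).const_mul 2
    exact ge_of_tendsto' ht fun n => (τ.apply_mono (hlh n)).trans (hhτ n)
  have hlim := φ.tendsto_apply_re hl
  rw [hlz, map_zero, Complex.zero_re] at hlim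
  have hC : 0 < 1 + C := by linarith [(norm_nonneg _).trans (hyC 0)]
  have hle : ∀ n, ε / (1 + C) ≤ (φ (h n)).re := fun n => by
    have h1 := φ.apply_mono (le_smul_boundedTransform (hy0 n) (hyC n))
    rw [← Complex.coe_smul, map_smul, smul_eq_mul, Complex.re_ofReal_mul] at h1
    have h2 := φ.apply_mono (hhy n)
    rw [div_le_iff₀ hC]
    have := hφy n
    nlinarith
  have := ge_of_tendsto' hlim hle
  have : 0 < ε / (1 + C) := by positivity
  linarith

/-- Absolute continuity of one trace norm with respect to another on bounded sets; it lets
convergence of averages pass between traces. A failure at each `δ = 2⁻ⁿ` would give a sequence `xₙ*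
xₙ` excluded by `not_forall_le`. -/
theorem Complete.exists_norm_le (hτ : τ.Complete) {φ : FaithfulTrace A} (hφ : φ.Complete)
    (C : ℝ) {ε : ℝ} (hε : 0 < ε) :
    ∃ δ > 0, ∀ x : A, ‖x‖ ≤ C → ‖τ.toL2 x‖ ≤ δ → ‖φ.toL2 x‖ < ε := by
  by_contra! hcon
  choose x hxC hxτ hxφ using fun n : ℕ => hcon ((1 / 2) ^ n) (by positivity)
  refine hτ.not_forall_le hφ (y := fun n => star (x n) * x n) (fun n => star_mul_self_nonneg _)
    (C := C * C) (fun n => ?_) (fun n => ?_) (ε := ε ^ 2) (by positivity) fun n => ?_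
  · rw [CStarRing.norm_star_mul_self]
    exact mul_self_le_mul_self (norm_nonneg _) (hxC n)
  · rw [← norm_toL2_sq]
    calc ‖τ.toL2 (x n)‖ ^ 2 ≤ ((1 / 2) ^ n) ^ 2 := by gcongr; exact hxτ n
      _ ≤ (1 / 2) ^ n := by
        rw [← pow_mul]
        exact pow_le_pow_of_le_one (by norm_num) (by norm_num) (by omega)
  · rw [← norm_toL2_sq]
    gcongr
    exact hxφ n

omit [PartialOrder A] [StarOrderedRing A] in
/-- The Dixmier averaging property. -/
theorem Complete.exists_average (hτ : τ.Complete) (hA : HasTrivialCenter A) (x : A) :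
    ∃ (c : ℂ) (y : ℕ → A), c * τ 1 = τ x ∧
      (∀ n, y n ∈ conjHull x) ∧
      Tendsto (fun n => τ.toL2 (y n)) atTop (𝓝 (τ.toL2 (c • 1))) := by
  set S := Set.range fun u : unitary A => (u : A) * x * star (u : A)
  have hconj : ∀ (u : unitary A), ∀ y ∈ convexHull ℝ S, (u : A) * y * star (u : A) ∈ convexHull ℝ S := by
    intro u y hy
    let f : A →ₗ[ℝ] A := (LinearMap.mulRight ℝ (star (u : A))).comp (LinearMap.mulLeft ℝ (u : A))
    have : f '' (convexHull ℝ S) ⊆ convexHull ℝ S := by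
      rw [f.image_convexHull]
      refine convexHull_mono ?_
      rintro _ ⟨_, ⟨v, rfl⟩, rfl⟩
      exact ⟨u * v, by simp [f, mul_assoc]⟩
    exact this ⟨y, hy, rfl⟩
  let T : A →ₗ[ℝ] τ.L2 := (τ.toL2 : A →ₗ[ℂ] τ.L2).restrictScalars ℝ
  -- A point fixed by all unitary conjugations commutes with the unitaries, hence with their span,
  -- the whole algebra, and is therefore a scalar.
  obtain ⟨y, hy, hfix⟩ := exists_fixed_mem_closure (K := T '' convexHull ℝ S)
    (((Set.range_nonempty _).convexHull).image _) ((convex_convexHull ℝ S).linear_image T)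
    (fun z hz hcau => by
      choose w hw hwz using hz
      obtain rfl : (fun n => τ.toL2 (w n)) = z := funext hwz
      obtain ⟨y, hy⟩ := hτ w ⟨‖x‖, fun n => norm_le_of_mem_conjHull (hw n)⟩ hcau
      exact ⟨_, hy⟩)
    (fun u : unitary A => τ.toL2.toLinearMap ∘ₗ (LinearMap.mulRight ℂ (star (u : A)) ∘ₗ
      LinearMap.mulLeft ℂ (u : A)) ∘ₗ τ.toL2.symm.toLinearMap)
    (fun u z => by
      obtain ⟨z, rfl⟩ := τ.toL2.surjective z
      simp only [LinearMap.comp_apply, LinearEquiv.coe_coe, LinearEquiv.symm_apply_apply,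
        LinearMap.mulLeft_apply, LinearMap.mulRight_apply]
      exact (τ.norm_toL2_mul_le_of_proj (p := 1) (by simp) (by simp)).trans
        (τ.norm_toL2_mul_le_of_proj_left (p := 1) (by simp) (by simp)))
    (by
      rintro u _ ⟨z, hz, rfl⟩
      exact ⟨_, hconj u z hz, rfl⟩)
  obtain ⟨y, rfl⟩ := τ.toL2.surjective y
  have hcomm : ∀ u : unitary A, y * u = u * y := fun u => by
    have h1 : (u : A) * y * star (u : A) = y := τ.toL2.injective (hfix u)
    calc y * u = u * y * star (u : A) * u := by rw [h1]
      _ = u * y := by rw [mul_assoc]; simp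
  obtain ⟨c, hc⟩ := hA y fun z => by
    have hz : z ∈ Submodule.span ℂ (unitary A : Set A) := by
      rw [CStarAlgebra.span_unitary]; trivial
    induction hz using Submodule.span_induction with
    | mem z hz => exact hcomm ⟨z, hz⟩
    | zero => simp
    | add a b _ _ ha hb => rw [mul_add, add_mul, ha, hb]
    | smul r a _ ha => rw [mul_smul_comm, smul_mul_assoc, ha]
  obtain ⟨z, hz, hlim⟩ := mem_closure_iff_seq_limit.mp hy
  choose w hw hwz using hz
  obtain rfl : (fun n => τ.toL2 (w n)) = z := funext hwz
  refine ⟨c, w, ?_, hw, hc ▸ hlim⟩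
  have h1 := τ.tendsto_apply hlim
  have h2 : τ y = τ x := tendsto_nhds_unique h1 (by simp [τ.apply_eq_of_mem_conjHull (hw _)])
  rw [← h2, hc, map_smul, smul_eq_mul]

/-- Uniqueness of the trace. -/
theorem Complete.apply_mul_apply_one (hτ : τ.Complete) (hA : HasTrivialCenter A)
    {φ : FaithfulTrace A} (hφ : φ.Complete) (x : A) : φ x * τ 1 = τ x * φ 1 := by
  obtain ⟨c, y, hc, hy, hlim⟩ := hτ.exists_average hA x
  -- The same averages of `x` tend to `c·1` for both traces, and each trace is constant along them.
  have hφlim : Tendsto (fun n => φ.toL2 (y n)) atTop (𝓝 (φ.toL2 (c • 1))) := by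
    rw [Metric.tendsto_atTop] at hlim ⊢
    intro ε hε
    obtain ⟨δ, hδ, h⟩ := hτ.exists_norm_le hφ (‖x‖ + ‖c • (1 : A)‖) hε
    obtain ⟨N, hN⟩ := hlim δ hδ
    refine ⟨N, fun n hn => ?_⟩
    have := hN n hn
    rw [dist_eq_norm, ← map_sub] at this ⊢
    exact h _ ((norm_sub_le _ _).trans (by gcongr; exact norm_le_of_mem_conjHull (hy n))) this.le
  have h2 : φ (c • 1) = φ x :=
    tendsto_nhds_unique (φ.tendsto_apply hφlim) (by simp [φ.apply_eq_of_mem_conjHull (hy _)])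
  rw [← h2, ← hc, map_smul, smul_eq_mul]
  ring

end FaithfulTrace

end

/-! ### Corner embeddings -/

noncomputable section

open Filter Topology

/-- An isomorphism of a unital star algebra with a corner `pQp`. -/
structure IsCornerEmbedding {N Q : Type*} [Ring N] [StarRing N] [Algebra ℂ N]
    [Ring Q] [StarRing Q] [Algebra ℂ Q] (ι : N →⋆ₙₐ[ℂ] Q) : Prop where
  injective : Function.Injective ι
  exists_eq : ∀ x, ∃ y, ι y = ι 1 * x * ι 1

namespace FaithfulTrace

variable {N A : Type*} [CStarAlgebra N]
  [CStarAlgebra A] [PartialOrder A] [StarOrderedRing A]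

/-- The restriction of a faithful trace along an injective homomorphism. -/
def comap (τ : FaithfulTrace A) (ι : N →⋆ₙₐ[ℂ] A) (hι : Function.Injective ι) :
    FaithfulTrace N where
  toLin := τ.toLin ∘ₗ (ι : N →ₗ[ℂ] A)
  nonneg' x := by simpa [map_star] using τ.nonneg (ι x)
  faithful' x h := by
    have : ι x = 0 := τ.faithful' _ (by simpa [map_star] using h)
    exact hι (this.trans (map_zero ι).symm)
  tracial' x y := by simpa using τ.mul_comm (ι x) (ι y)

omit [PartialOrder A] [StarOrderedRing A] in
theorem comap_apply (τ : FaithfulTrace A) {ι : N →⋆ₙₐ[ℂ] A} (hι : Function.Injective ι) (x : N) :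
    τ.comap ι hι x = τ (ι x) := rfl

omit [PartialOrder A] [StarOrderedRing A] in
theorem norm_toL2_comap (τ : FaithfulTrace A) {ι : N →⋆ₙₐ[ℂ] A} (hι : Function.Injective ι)
    (x : N) : ‖(τ.comap ι hι).toL2 x‖ = ‖τ.toL2 (ι x)‖ := by
  rw [← sq_eq_sq₀ (norm_nonneg _) (norm_nonneg _), norm_toL2_sq, norm_toL2_sq, comap_apply,
    map_mul, map_star]

end FaithfulTrace

namespace IsCornerEmbedding

section Ring

variable {N Q : Type*} [Ring N] [StarRing N] [Algebra ℂ N] [Ring Q] [StarRing Q] [Algebra ℂ Q]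
  {ι : N →⋆ₙₐ[ℂ] Q}

theorem one_mul_apply (ι : N →⋆ₙₐ[ℂ] Q) (x : N) : ι 1 * ι x = ι x := by rw [← map_mul, one_mul]

theorem apply_mul_one (ι : N →⋆ₙₐ[ℂ] Q) (x : N) : ι x * ι 1 = ι x := by rw [← map_mul, mul_one]

theorem star_one (ι : N →⋆ₙₐ[ℂ] Q) : star (ι 1) = ι 1 := by rw [← map_star, _root_.star_one]

theorem comp_equiv {N' : Type*} [Ring N'] [StarRing N'] [Algebra ℂ N'] (hι : IsCornerEmbedding ι)
    (α : N' ≃⋆ₐ[ℂ] N) :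
    IsCornerEmbedding (ι.comp (α : N' →⋆ₐ[ℂ] N).toNonUnitalStarAlgHom) where
  injective := hι.injective.comp α.injective
  exists_eq x := by
    obtain ⟨y, hy⟩ := hι.exists_eq x
    exact ⟨α.symm y, by simpa using hy⟩

end Ring

variable {N A : Type*} [CStarAlgebra N] [CStarAlgebra A] [PartialOrder A] [StarOrderedRing A]
  {τ : FaithfulTrace A} {ι : N →⋆ₙₐ[ℂ] A}

/-- The limit in `A` may fall outside the corner, but the compression `p · p` is continuous and
fixes the sequence. -/
theorem complete_comap (hι : IsCornerEmbedding ι) (hτ : τ.Complete) :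
    (τ.comap ι hι.injective).Complete := by
  rintro x ⟨C, hC⟩ hx
  have hx' : CauchySeq fun n => τ.toL2 (ι (x n)) := by
    rw [Metric.cauchySeq_iff] at hx ⊢
    simpa only [dist_eq_norm, ← map_sub, τ.norm_toL2_comap] using hx
  obtain ⟨y, hy⟩ := hτ (fun n => ι (x n))
    ⟨C, fun n => (NonUnitalStarAlgHom.norm_apply_le ι _).trans (hC n)⟩ hx'
  obtain ⟨z, hz⟩ := hι.exists_eq y
  refine ⟨z, ?_⟩
  have h1 := τ.tendsto_mul_right (ι 1) (τ.tendsto_mul_left (ι 1) hy)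
  rw [tendsto_iff_norm_sub_tendsto_zero] at h1 ⊢
  simp only [← hz, one_mul_apply, apply_mul_one] at h1
  simpa only [← map_sub, τ.norm_toL2_comap] using h1

/-- For a self-adjoint central `z` of the corner, put `Z = ι z`, `p = ι 1`. Then `Z a p = p a Z` for
all `a`. Averaging `p + iZ` averages `p` and `Z` by the same unitaries, and the swap identity
becomes an `ℝ`-linear closed relation on the averages. At the limit `c·1` it reads `Re(c) Z = Im(c)
p`. -/
theorem hasTrivialCenter (hι : IsCornerEmbedding ι) (hτ : τ.Complete) (hA : HasTrivialCenter A) :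
    HasTrivialCenter N := by
  have key : ∀ z : N, IsSelfAdjoint z → (∀ x, z * x = x * z) → ∃ c : ℂ, z = c • (1 : N) := by
    intro z hz hzc
    by_cases hp : ι 1 = 0
    · refine ⟨0, hι.injective ?_⟩
      rw [← one_mul_apply ι z, hp]; simp
    have hZ : star (ι z) = ι z := by rw [← map_star, hz.star_eq]
    have hswap : ∀ a, ι z * a * ι 1 = ι 1 * a * ι z := by
      intro a
      obtain ⟨b, hb⟩ := hι.exists_eq a
      calc ι z * a * ι 1 = ι z * (ι 1 * a * ι 1) := by
            rw [← mul_assoc, ← mul_assoc, apply_mul_one]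
        _ = (ι 1 * a * ι 1) * ι z := by rw [← hb, ← map_mul, hzc, map_mul]
        _ = _ := by rw [mul_assoc, one_mul_apply]
    obtain ⟨c, y, hc, hy, hlim⟩ := hτ.exists_average hA (ι 1 + Complex.I • ι z)
    let R : A → Prop := fun w => ι z * (w + star w) = -(Complex.I • (ι 1 * (w - star w)))
    have hR : ∀ n, R (y n) := by
      intro n
      have : FaithfulTrace.conjHull (ι 1 + Complex.I • ι z) ⊆ {w | R w} := by
        refine convexHull_min ?_ ?_
        · rintro _ ⟨u, rfl⟩
          have e1 : star ((u : A) * (ι 1 + Complex.I • ι z) * star (u : A)) =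
              u * (ι 1 - Complex.I • ι z) * star (u : A) := by
            simp [hZ, star_one, mul_assoc, sub_eq_add_neg]
          have h2 := hswap u
          change _ = _
          rw [e1, ← add_mul, ← mul_add, ← sub_mul, ← mul_sub]
          have e2 : ι 1 + Complex.I • ι z + (ι 1 - Complex.I • ι z) = (2 : ℂ) • ι 1 := by
            module
          have e3 : ι 1 + Complex.I • ι z - (ι 1 - Complex.I • ι z) = (2 * Complex.I) • ι z := by
            module
          rw [e2, e3]
          simp only [mul_smul_comm, smul_mul_assoc, smul_smul, ← mul_assoc, h2, ← neg_smul]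
          congr 1
          linear_combination 2 * Complex.I_mul_I
        · intro a ha b hb s t _ _ _
          change ι z * (a + star a) = _ at ha
          change ι z * (b + star b) = _ at hb
          change _ = _
          simp only [← Complex.coe_smul, star_add, star_smul, Complex.star_def, Complex.conj_ofReal]
          calc _ = (s : ℂ) • (ι z * (a + star a)) + (t : ℂ) • (ι z * (b + star b)) := by
                simp only [mul_add, mul_smul_comm]; module
            _ = _ := by
                rw [ha, hb]; simp only [mul_add, mul_sub, mul_smul_comm]; module
      exact this (hy n)
    have hlim' := τ.tendsto_star hlim
    have hRc : R (c • 1) := by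
      have l1 := τ.tendsto_mul_left (ι z) (x := fun n => y n + star (y n)) (y := c • 1 + star (c • 1))
        (by simpa only [map_add] using hlim.add hlim')
      have l2 := τ.tendsto_mul_left (ι 1) (x := fun n => y n - star (y n)) (y := c • 1 - star (c • 1))
        (by simpa only [map_sub] using hlim.sub hlim')
      have l3 := (l2.const_smul Complex.I).neg
      have : ∀ n, τ.toL2 (ι z * (y n + star (y n))) =
          - (Complex.I • τ.toL2 (ι 1 * (y n - star (y n)))) := fun n => by
        rw [← map_smul, ← map_neg]; exact congrArg _ (hR n)
      simp only [this] at l1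
      have := tendsto_nhds_unique l1 l3
      rw [← map_smul, ← map_neg] at this
      exact τ.toL2.injective this
    change _ = _ at hRc
    have e1 : c • (1 : A) + star (c • 1) = ((2 * c.re : ℝ) : ℂ) • 1 := by
      rw [star_smul, _root_.star_one, ← add_smul]
      congr 1
      apply Complex.ext <;> simp [two_mul]
    have e2 : c • (1 : A) - star (c • 1) = (2 * c.im * Complex.I : ℂ) • 1 := by
      rw [star_smul, _root_.star_one, ← sub_smul]
      congr 1
      apply Complex.ext <;> simp [two_mul]
    rw [e1, e2, mul_smul_comm, mul_smul_comm, mul_one, mul_one, smul_smul, ← neg_smul] at hRc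
    -- `Re(c) τ(1) = τ(p)`, because `τ(Z)` and `τ(1)` are real, and `τ(p) ≠ 0` by faithfulness.
    have hcre : c.re ≠ 0 := by
      intro h0
      have h1 := congrArg Complex.re hc
      have hz0 : (τ (ι z)).im = 0 := by
        have := τ.apply_star (ι z)
        rw [hZ] at this
        exact Complex.conj_eq_iff_im.mp this.symm
      have h10 : (τ 1).im = 0 := by
        have := τ.apply_star 1
        rw [_root_.star_one] at this
        exact Complex.conj_eq_iff_im.mp this.symm
      simp [h0, h10, hz0] at h1
      have h2 : ‖τ.toL2 (ι 1)‖ ^ 2 = 0 := by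
        rw [τ.norm_toL2_sq, star_one, one_mul_apply, ← h1]
      exact hp (by simpa using h2)
    refine ⟨c.im / c.re, hι.injective ?_⟩
    rw [map_smul]
    have hc2 : ((2 * c.re : ℝ) : ℂ) ≠ 0 := by
      rw [Complex.ofReal_ne_zero]; simpa using hcre
    have hcre' : (c.re : ℂ) ≠ 0 := Complex.ofReal_ne_zero.mpr hcre
    calc ι z = ((2 * c.re : ℝ) : ℂ)⁻¹ • ((2 * c.re : ℝ) : ℂ) • ι z := by
          rw [smul_smul, inv_mul_cancel₀ hc2, one_smul]
      _ = _ := by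
          rw [hRc, smul_smul]
          congr 1
          push_cast
          field_simp
          linear_combination - (c.im : ℂ) * Complex.I_mul_I
  intro z hz
  have hz' : ∀ x, star z * x = x * star z := fun x => by
    have := congrArg star (hz (star x))
    simpa using this.symm
  obtain ⟨a, ha⟩ := key (z + star z) (by simp [IsSelfAdjoint, add_comm])
    fun x => by rw [add_mul, mul_add, hz, hz']
  obtain ⟨b, hb⟩ := key (Complex.I • (z - star z))
    (by simp [IsSelfAdjoint, smul_sub]; abel)
    fun x => by simp only [smul_mul_assoc, mul_smul_comm, sub_mul, mul_sub, hz, hz']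
  refine ⟨a / 2 - Complex.I * b / 2, ?_⟩
  have : z = (1 / 2 : ℂ) • (z + star z) - (Complex.I / 2) • (Complex.I • (z - star z)) := by
    rw [smul_smul, show Complex.I / 2 * Complex.I = -(1 / 2) by
      linear_combination Complex.I_mul_I / 2]
    module
  rw [this, ha, hb]
  module

/-- Corner embeddings into a factor scale the trace. -/
theorem apply_mul_apply_one (hι : IsCornerEmbedding ι) (hτ : τ.Complete) (hA : HasTrivialCenter A)
    [PartialOrder N] [StarOrderedRing N]
    {φ : FaithfulTrace N} (hφ : φ.Complete) (x : N) : φ x * τ (ι 1) = τ (ι x) * φ 1 :=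
  (hι.complete_comap hτ).apply_mul_apply_one (hι.hasTrivialCenter hτ hA) hφ x

end IsCornerEmbedding

end

/-! ### Polar decomposition -/

noncomputable section

open Filter Topology

namespace FaithfulTrace

section Polar

variable {A : Type*} [CStarAlgebra A] [PartialOrder A] [StarOrderedRing A]

omit [PartialOrder A] [StarOrderedRing A] in
theorem star_mul_cfc_mul_self {x : A} {D : ℝ → ℝ}
    (hD : ContinuousOn D (spectrum ℝ (star x * x))) :
    star (x * cfc D (star x * x)) * (x * cfc D (star x * x)) =
      cfc (fun t => D t * t * D t) (star x * x) := by
  have hsa : star (cfc D (star x * x)) = cfc D (star x * x) :=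
    (cfc_predicate D (star x * x)).star_eq
  have hc : IsSelfAdjoint (star x * x) := .star_mul_self x
  rw [star_mul, hsa, mul_assoc, ← mul_assoc (star x), ← mul_assoc]
  conv_lhs => enter [1, 2]; rw [← cfc_id' ℝ (star x * x)]
  rw [← cfc_mul .., ← cfc_mul ..]

/-- The functions `(t + 1 / (n + 1)) ^ (-1 / 2)`. -/
def polarFun (n : ℕ) (t : ℝ) : ℝ := (√(t + 1 / ((n : ℝ) + 1)))⁻¹

theorem polarFun_pos {t : ℝ} (ht : 0 ≤ t) (n : ℕ) : 0 < polarFun n t := by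
  have : 0 < t + 1 / ((n : ℝ) + 1) := by positivity
  exact inv_pos.mpr (Real.sqrt_pos.mpr this)

theorem polarFun_sq {t : ℝ} (ht : 0 ≤ t) (n : ℕ) :
    polarFun n t ^ 2 * (t + 1 / ((n : ℝ) + 1)) = 1 := by
  have : 0 < t + 1 / ((n : ℝ) + 1) := by positivity
  rw [polarFun, inv_pow, Real.sq_sqrt this.le, inv_mul_cancel₀ this.ne']

theorem polarFun_mono {t : ℝ} (ht : 0 ≤ t) {m n : ℕ} (h : m ≤ n) : polarFun m t ≤ polarFun n t := by
  have : 0 < t + 1 / ((n : ℝ) + 1) := by positivity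
  refine inv_anti₀ (Real.sqrt_pos.mpr this) (Real.sqrt_le_sqrt ?_)
  gcongr

theorem continuousOn_polarFun {s : Set ℝ} (hs : ∀ t ∈ s, 0 ≤ t) (n : ℕ) :
    ContinuousOn (polarFun n) s := by
  refine ContinuousOn.inv₀ (by fun_prop) fun t ht => ?_
  have := hs t ht
  have : 0 < t + 1 / ((n : ℝ) + 1) := by positivity
  exact (Real.sqrt_pos.mpr this).ne'

variable {τ : FaithfulTrace A}

/-- A partial isometry in the place of the polar part of a contraction. -/
theorem Complete.exists_polar (hτ : τ.Complete) {x : A} (hx : ‖x‖ ≤ 1) :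
    ∃ w : A, w * star w * w = w ∧ (∀ g, g * x = x → g * w = w) ∧
      (∀ f, IsSelfAdjoint f → x * f = x → w * f = w) ∧
      (τ (star x * x)).re ≤ (τ (star w * w)).re := by
  rcases subsingleton_or_nontrivial A with hA | hA
  · exact ⟨x, Subsingleton.elim _ _, fun _ h => h, fun _ _ h => h, le_rfl⟩
  set c := star x * x with hcdef
  have hc0 : 0 ≤ c := star_mul_self_nonneg x
  have hcsa : IsSelfAdjoint c := hc0.isSelfAdjoint
  have hcn : ‖c‖ ≤ 1 := by
    rw [hcdef, CStarRing.norm_star_mul_self]; exact mul_le_one₀ hx (norm_nonneg _) hx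
  have hs0 : ∀ t ∈ spectrum ℝ c, 0 ≤ t := fun t ht => spectrum_nonneg_of_nonneg hc0 ht
  have hs1 : ∀ t ∈ spectrum ℝ c, t ≤ 1 := fun t ht =>
    (le_abs_self t).trans ((spectrum.norm_le_norm_of_mem ht).trans hcn)
  have hG := continuousOn_polarFun hs0
  let r : ℕ → ℝ := fun n => 1 / ((n : ℝ) + 1)
  have hr : ∀ n, 0 < r n := fun n => by positivity
  let G : ℕ → A := fun n => cfc (polarFun n) c
  -- `w n = x (x*x + 1/(n+1))^{-1/2}` approximates the polar part, and `S n = w n* w n` approximates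
  -- its initial projection.
  let w : ℕ → A := fun n => x * G n
  let S : ℕ → A := fun n => cfc (fun t => polarFun n t * t * polarFun n t) c
  have hSc : ∀ n, ContinuousOn (fun t => polarFun n t * t * polarFun n t) (spectrum ℝ c) :=
    fun n => ((hG n).mul continuousOn_id).mul (hG n)
  have hwS : ∀ n, star (w n) * w n = S n := fun n => star_mul_cfc_mul_self (hG n)
  have hS1 : ∀ n, S n ≤ 1 := fun n => cfc_le_one _ _ fun t ht => by
    have h1 := polarFun_sq (hs0 t ht) n
    have h2 : 0 ≤ polarFun n t ^ 2 * (1 / ((n : ℝ) + 1)) := by positivity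
    linarith [show polarFun n t * t * polarFun n t = polarFun n t ^ 2 * t by ring]
  have hS0 : ∀ n, 0 ≤ S n := fun n => by rw [← hwS]; exact star_mul_self_nonneg _
  have hwn : ∀ n, ‖w n‖ ≤ 1 := fun n => by
    have h1 := (CStarAlgebra.norm_le_one_iff_of_nonneg _ (hS0 n)).mpr (hS1 n)
    rw [← hwS, CStarRing.norm_star_mul_self] at h1
    nlinarith [norm_nonneg (w n)]
  -- For scalars `0 ≤ a ≤ b` one has `(b - a)² ≤ b² - a²`; here `a`, `b` are the values of `polarFun
  -- m` and `polarFun n`.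
  have hdiff : ∀ m n, m ≤ n → ‖τ.toL2 (w n) - τ.toL2 (w m)‖ ^ 2 ≤ (τ (S n)).re - (τ (S m)).re := by
    intro m n hmn
    have e : w n - w m = x * cfc (fun t => polarFun n t - polarFun m t) c := by
      simp only [w, G]
      rw [← mul_sub, ← cfc_sub _ _ _ (hG n) (hG m)]
    rw [← map_sub, norm_toL2_sq, e, star_mul_cfc_mul_self
      (D := fun t => polarFun n t - polarFun m t) ((hG n).sub (hG m)), ← Complex.sub_re,
      ← map_sub]
    simp only [S]
    rw [← cfc_sub _ _ _ (hSc n) (hSc m)]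
    refine τ.apply_mono (cfc_mono (fun t ht => ?_)
      ((((hG n).sub (hG m)).mul continuousOn_id).mul ((hG n).sub (hG m))) ((hSc n).sub (hSc m)))
    have h1 := polarFun_mono (hs0 t ht) hmn
    have h2 := (polarFun_pos (hs0 t ht) m).le
    have h3 := hs0 t ht
    nlinarith [mul_nonneg h3 (mul_nonneg h2 (sub_nonneg.mpr h1))]
  have hmono : Monotone fun n => (τ (S n)).re := fun m n hmn => by
    have := hdiff m n hmn
    have h2 := sq_nonneg ‖τ.toL2 (w n) - τ.toL2 (w m)‖
    simp only; linarith
  have hcau : CauchySeq fun n => τ.toL2 (w n) := by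
    have hcau : CauchySeq fun n => (τ (S n)).re := (tendsto_atTop_ciSup hmono
      ⟨(τ 1).re, by rintro _ ⟨n, rfl⟩; exact τ.apply_mono (hS1 n)⟩).cauchySeq
    rw [Metric.cauchySeq_iff'] at hcau ⊢
    intro ε hε
    obtain ⟨N, hN⟩ := hcau (ε ^ 2) (by positivity)
    refine ⟨N, fun n hn => ?_⟩
    have h2 := hN n hn
    rw [Real.dist_eq] at h2
    rw [dist_eq_norm]
    exact lt_of_pow_lt_pow_left₀ 2 hε.le
      ((hdiff N n hn).trans_lt ((le_abs_self _).trans_lt h2))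
  obtain ⟨v, hv⟩ := hτ w ⟨1, hwn⟩ hcau
  set s := star v * v with hs
  have hSs : Tendsto (fun n => τ.toL2 (S n)) atTop (𝓝 (τ.toL2 s)) := by
    rw [tendsto_iff_norm_sub_tendsto_zero]
    have hv0 := tendsto_iff_norm_sub_tendsto_zero.mp hv
    refine squeeze_zero (fun _ => norm_nonneg _) (fun n => ?_)
      (by simpa using hv0.mul_const (1 + ‖v‖))
    have e : S n - s = star (w n) * (w n - v) + star (w n - v) * v := by
      rw [← hwS, hs, star_sub]; noncomm_ring
    rw [← map_sub, e, map_add]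
    refine (norm_add_le _ _).trans ?_
    have h1 := τ.norm_toL2_mul_le (star (w n)) (w n - v)
    have h2 := τ.norm_toL2_mul_le' (star (w n - v)) v
    rw [norm_star] at h1
    rw [norm_toL2_star] at h2
    rw [← map_sub]
    nlinarith [hwn n, norm_nonneg (τ.toL2 (w n - v))]
  -- With `r n = 1/(n+1)`, the operator norm of `S n S m - S n` is at most `r m / r n`, which
  -- vanishes as `m → ∞`. Letting `n → ∞` afterwards makes `s` idempotent.
  have hSS : ∀ n, S n * s = S n := by
    intro n
    refine τ.toL2.injective (tendsto_nhds_unique (τ.tendsto_mul_left (S n) hSs) ?_)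
    rw [tendsto_iff_norm_sub_tendsto_zero]
    have hlim : Tendsto (fun m => (r n)⁻¹ * r m * ‖τ.toL2 1‖) atTop (𝓝 0) := by
      have := ((tendsto_one_div_add_atTop_nhds_zero_nat (𝕜 := ℝ)).const_mul (r n)⁻¹).mul_const
        ‖τ.toL2 1‖
      rwa [mul_zero, zero_mul] at this
    refine squeeze_zero (fun _ => norm_nonneg _) (fun m => ?_) hlim
    rw [← map_sub]
    refine (τ.norm_toL2_le _).trans (mul_le_mul_of_nonneg_right ?_ (norm_nonneg _))
    simp only [S]
    rw [← cfc_mul _ _ _ (hSc n) (hSc m), ← cfc_sub (fun t => polarFun n t * t * polarFun n t *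
      (polarFun m t * t * polarFun m t)) _ _ ((hSc n).mul (hSc m)) (hSc n)]
    refine norm_cfc_le (by have := hr n; have := hr m; positivity) fun t ht => ?_
    have h0 := hs0 t ht
    have e1 := polarFun_sq h0 n
    have e2 := polarFun_sq h0 m
    have hp1 : 0 ≤ polarFun n t ^ 2 := sq_nonneg _
    have hp2 : 0 ≤ polarFun m t ^ 2 := sq_nonneg _
    have hrn := hr n
    have hrm := hr m
    change polarFun n t ^ 2 * (t + r n) = 1 at e1
    change polarFun m t ^ 2 * (t + r m) = 1 at e2
    set a := polarFun n t ^ 2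
    set b := polarFun m t ^ 2
    have e3 : polarFun n t * t * polarFun n t * (polarFun m t * t * polarFun m t) -
        polarFun n t * t * polarFun n t = - (a * (t * b) * r m) := by
      linear_combination (a * t) * e2
    have hb : t * b ≤ 1 := by nlinarith
    have ha : a ≤ (r n)⁻¹ := by
      refine le_of_mul_le_mul_right (a := r n) ?_ hrn
      rw [inv_mul_cancel₀ hrn.ne']
      nlinarith
    rw [e3, norm_neg, Real.norm_of_nonneg (by positivity)]
    refine mul_le_mul_of_nonneg_right ?_ hrm.le
    calc a * (t * b) ≤ a * 1 := by gcongr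
      _ ≤ _ := by simpa using ha
  have hss : s * s = s := by
    refine τ.toL2.injective (tendsto_nhds_unique (τ.tendsto_mul_right s hSs) ?_)
    simpa only [hSS] using hSs
  refine ⟨v, ?_, fun g hg => ?_, fun f hf hxf => ?_, ?_⟩
  · rw [mul_assoc, ← hs, ← sub_eq_zero, ← CStarRing.star_mul_self_eq_zero_iff]
    have hssa : star s = s := by rw [hs]; simp
    calc star (v * s - v) * (v * s - v) = s * s * s - s * s - s * s + s := by
          rw [star_sub, star_mul, hssa, hs]; noncomm_ring
      _ = 0 := by rw [hss, hss]; abel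
  · refine τ.toL2.injective (tendsto_nhds_unique (τ.tendsto_mul_left g hv) ?_)
    simpa only [w, ← mul_assoc, hg] using hv
  · refine τ.toL2.injective (tendsto_nhds_unique (τ.tendsto_mul_right f hv) ?_)
    have h1 : c * f = c := by rw [hcdef, mul_assoc, hxf]
    have h2 : f * c = c := by simpa [hf.star_eq, hcsa.star_eq] using congrArg star h1
    have h3 : ∀ n, Commute (G n) f := fun n =>
      (Commute.cfc_real (show Commute c f from h1.trans h2.symm) _)
    have h4 : ∀ n, w n * f = w n := fun n => by
      rw [mul_assoc, (h3 n).eq, ← mul_assoc, hxf]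
    simpa only [h4] using hv
  · have hlim : Tendsto (fun n => (1 + r n) * (τ (S n)).re) atTop (𝓝 ((1 + 0) * (τ s).re)) :=
      ((tendsto_one_div_add_atTop_nhds_zero_nat (𝕜 := ℝ)).const_add 1).mul (τ.tendsto_apply_re hSs)
    rw [add_zero, one_mul] at hlim
    refine ge_of_tendsto' hlim fun n => ?_
    -- The spectrum of `c` lies in `[0, 1]`, where `t ≤ (1 + r) t/(t + r)`.
    have h1 : c ≤ (1 + r n) • S n := by
      simp only [S]
      rw [← cfc_smul _ _ _ (hSc n)]
      conv_lhs => rw [← cfc_id' ℝ c]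
      refine cfc_mono (fun t ht => ?_) (by fun_prop) ((hSc n).const_smul (1 + r n))
      have h0 := hs0 t ht
      have h1 := hs1 t ht
      have e1 := polarFun_sq h0 n
      change polarFun n t ^ 2 * (t + r n) = 1 at e1
      simp only [smul_eq_mul]
      nlinarith [mul_nonneg (mul_nonneg h0 (sq_nonneg (polarFun n t))) (sub_nonneg.mpr h1)]
    have h2 := τ.apply_mono h1
    rwa [← Complex.coe_smul, map_smul, smul_eq_mul, Complex.re_ofReal_mul] at h2

end Polar

end FaithfulTrace

end

/-! ### Comparison of projections -/

noncomputable section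

open Filter Topology

namespace FaithfulTrace

section Comparison

theorem isStarProjection_star_mul_self {A : Type*} [Ring A] [StarRing A] {w : A} (hw : w * star w * w = w) :
    IsStarProjection (star w * w) where
  isIdempotentElem := by
    change _ = _
    rw [mul_assoc, ← mul_assoc w, hw]
  isSelfAdjoint := .star_mul_self w

variable {A : Type*} [CStarAlgebra A]

theorem norm_le_one_of_partialIsometry {w : A} (hw : w * star w * w = w) : ‖w‖ ≤ 1 := by
  have h := (isStarProjection_star_mul_self hw).norm_le
  rw [CStarRing.norm_star_mul_self] at h
  nlinarith [norm_nonneg w]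

variable [PartialOrder A] [StarOrderedRing A] {τ : FaithfulTrace A}

theorem re_apply_projection_nonneg (τ : FaithfulTrace A) {p : A} (hp : IsStarProjection p) :
    0 ≤ (τ p).re := τ.re_apply_nonneg hp.nonneg

/-- The averages of `f` tend to `τ(f)·1`, so the numbers `τ(g u f u*)` average to `τ(g) τ(f)` in the
limit, and they cannot all be less than half of it. When the product vanishes, `u = 1` suffices. -/
theorem Complete.exists_unitary_le (hτ : τ.Complete) (hA : HasTrivialCenter A) (hτ1 : τ 1 = 1)
    {g f : A} (hg : IsStarProjection g) (hf : IsStarProjection f) :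
    ∃ u : unitary A, (τ g).re * (τ f).re / 2 ≤ (τ (g * (u * f * star (u : A)))).re := by
  have hg0 := τ.re_apply_projection_nonneg hg
  have hf0 := τ.re_apply_projection_nonneg hf
  by_contra! hcon
  obtain ⟨c, y, hc, hy, hlim⟩ := hτ.exists_average hA f
  rw [hτ1, mul_one] at hc
  have hle : ∀ n, (τ (g * y n)).re ≤ (τ g).re * (τ f).re / 2 := by
    intro n
    have : conjHull f ⊆ {y | (τ (g * y)).re ≤ (τ g).re * (τ f).re / 2} := by
      refine convexHull_min ?_ ?_
      · rintro _ ⟨u, rfl⟩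
        exact (hcon u).le
      · refine convex_halfSpace_le ⟨fun a b => ?_, fun r a => ?_⟩ _
        · simp [mul_add]
        · rw [mul_smul_comm, ← Complex.coe_smul, map_smul, smul_eq_mul, Complex.re_ofReal_mul,
            smul_eq_mul]
    exact this (hy n)
  have h1 := le_of_tendsto' ((Complex.continuous_re.tendsto _).comp (τ.tendsto_apply_mul g hlim)) hle
  rw [mul_smul_comm, mul_one, map_smul, smul_eq_mul, hc] at h1
  have him : (τ f).im = 0 := (Complex.nonneg_iff.mp (τ.apply_nonneg hf.nonneg)).2.symm
  simp only [Complex.mul_re, him, zero_mul, sub_zero] at h1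
  have h2 := hcon 1
  have h3 : 0 ≤ (τ (g * (((1 : unitary A) : A) * f * star ((1 : unitary A) : A)))).re := by
    have : g * (((1 : unitary A) : A) * f * star ((1 : unitary A) : A)) = g * f := by simp
    rw [this, ← hg.isIdempotentElem.eq, mul_assoc, τ.mul_comm]
    refine τ.re_apply_nonneg ?_
    have := star_left_conjugate_nonneg hf.nonneg g
    rwa [hg.isSelfAdjoint.star_eq] at this
  nlinarith

/-- The polar part of `g u f` for the unitary just found. The explicit lower bound is what makes the
exhaustion in `comparison` end with nothing left over. -/
theorem Complete.exists_partialIsometry (hτ : τ.Complete) (hA : HasTrivialCenter A)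
    (hτ1 : τ 1 = 1) {g f : A} (hg : IsStarProjection g) (hf : IsStarProjection f) :
    ∃ w : A, w * star w * w = w ∧ g * w = w ∧ w * f = w ∧
      (τ g).re * (τ f).re / 2 ≤ (τ (star w * w)).re := by
  obtain ⟨u, hu⟩ := hτ.exists_unitary_le hA hτ1 hg hf
  have hx : ‖g * u * f‖ ≤ 1 := by
    calc ‖g * u * f‖ ≤ ‖g * u‖ * ‖f‖ := norm_mul_le _ _
      _ = ‖g‖ * ‖f‖ := by rw [CStarRing.norm_mul_coe_unitary]
      _ ≤ 1 := mul_le_one₀ hg.norm_le (norm_nonneg _) hf.norm_le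
  obtain ⟨w, hw, hgw, hwf, hτw⟩ := hτ.exists_polar hx
  refine ⟨w, hw, hgw g ?_, hwf f hf.isSelfAdjoint ?_, le_trans (le_of_le_of_eq hu ?_) hτw⟩
  · rw [← mul_assoc, ← mul_assoc, hg.isIdempotentElem.eq]
  · rw [mul_assoc, hf.isIdempotentElem.eq]
  · have e : star (g * u * f) * (g * u * f) = f * (star (u : A) * (g * g) * u * f) := by
      rw [star_mul, star_mul, hg.isSelfAdjoint.star_eq, hf.isSelfAdjoint.star_eq]; noncomm_ring
    have h1 : τ (f * (star (u : A) * (g * g) * u * f)) = τ (star (u : A) * (g * u * f)) := by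
      rw [τ.mul_comm, hg.isIdempotentElem.eq, mul_assoc, hf.isIdempotentElem.eq]
      simp only [mul_assoc]
    rw [e, h1, τ.mul_comm (star (u : A))]
    simp only [mul_assoc]

/-- Comparison of projections. -/
theorem Complete.comparison (hτ : τ.Complete) (hA : HasTrivialCenter A) (hτ1 : τ 1 = 1)
    {g f : A} (hg : IsStarProjection g) (hf : IsStarProjection f) :
    ∃ w : A, g * w = w ∧ w * f = w ∧ w * star w * w = w ∧ (star w * w = f ∨ w * star w = g) := by
  let V := {v : A // v * star v * v = v ∧ g * v = v ∧ v * f = v}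
  have hleft : ∀ v : V, IsStarProjection (f - star v.1 * v.1) := fun v => by
    refine (isStarProjection_star_mul_self v.2.1).sub_of_mul_eq_left hf ?_
    rw [mul_assoc, v.2.2.2]
  have hright : ∀ v : V, IsStarProjection (g - v.1 * star v.1) := fun v => by
    have h1 : IsStarProjection (v.1 * star v.1) := by
      have := isStarProjection_star_mul_self (w := star v.1)
        (by simpa [mul_assoc] using congrArg star v.2.1)
      rwa [star_star] at this
    refine h1.sub_of_mul_eq_right hg ?_
    rw [← mul_assoc, v.2.2.1]
  -- Extend `v` by a partial isometry between the leftovers `f - v*v` and `g - vv*`. The trace grows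
  -- by at least half the product of the two deficits, so iterating in sequence replaces Zorn's
  -- lemma.
  have hstep : ∀ v : V, ∃ v' : V, star v.1 * v'.1 = star v.1 * v.1 ∧
      v'.1 * star v.1 = v.1 * star v.1 ∧
      ((τ g).re - (τ (star v.1 * v.1)).re) * ((τ f).re - (τ (star v.1 * v.1)).re) / 2 ≤
        (τ (star v'.1 * v'.1)).re - (τ (star v.1 * v.1)).re := by
    rintro ⟨v, hv, hgv, hvf⟩
    have hl := hleft ⟨v, hv, hgv, hvf⟩
    have hr := hright ⟨v, hv, hgv, hvf⟩
    obtain ⟨w, hw, hgw, hwf, hwτ⟩ := hτ.exists_partialIsometry hA hτ1 hr hl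
    simp only at hl hr hgw hwf hwτ
    have hvs : star v * v * star v = star v := by simpa [mul_assoc] using congrArg star hv
    have hvg : star v * g = star v := by
      simpa [hg.isSelfAdjoint.star_eq] using congrArg star hgv
    have hfv : f * star v = star v := by
      simpa [hf.isSelfAdjoint.star_eq] using congrArg star hvf
    have h1 : star v * w = 0 := by
      rw [← hgw, ← mul_assoc, mul_sub, hvg, ← mul_assoc, hvs, sub_self, zero_mul]
    have h2 : w * star v = 0 := by
      rw [← hwf, mul_assoc, sub_mul, hfv, hvs, sub_self, mul_zero]
    have h1' : star w * v = 0 := by simpa using congrArg star h1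
    have h2' : v * star w = 0 := by simpa using congrArg star h2
    have hgw' : g * w = w := by
      rw [← hgw, ← mul_assoc, mul_sub, hg.isIdempotentElem.eq, ← mul_assoc, hgv]
    have hwf' : w * f = w := by
      rw [← hwf, mul_assoc, sub_mul, hf.isIdempotentElem.eq, mul_assoc, hvf]
    have hpi : (v + w) * star (v + w) * (v + w) = v + w := by
      rw [star_add]
      calc (v + w) * (star v + star w) * (v + w) =
          v * star v * v + v * (star v * w) + v * star w * (v + w) + w * star v * (v + w)
            + w * (star w * v) + w * star w * w := by noncomm_ring
        _ = v + w := by rw [hv, hw, h1, h2, h1', h2']; simp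
    refine ⟨⟨v + w, hpi, by rw [mul_add, hgv, hgw'], by rw [add_mul, hvf, hwf']⟩, ?_, ?_, ?_⟩
    · simp only [mul_add, h1, add_zero]
    · simp only [add_mul, h2, add_zero]
    · simp only
      have e : star (v + w) * (v + w) = star v * v + star w * w := by
        rw [star_add]
        calc (star v + star w) * (v + w) = star v * v + star v * w + star w * v + star w * w := by
              noncomm_ring
          _ = _ := by rw [h1, h1']; simp
      rw [e, map_add, Complex.add_re, add_sub_cancel_left]
      simp only [map_sub, Complex.sub_re] at hwτ
      rwa [τ.mul_comm v] at hwτ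
  choose next hn1 hn2 hn3 using hstep
  let v : ℕ → V := fun n => next^[n] ⟨0, by simp, by simp, by simp⟩
  have hvsucc : ∀ n, v (n + 1) = next (v n) := fun n => Function.iterate_succ_apply' _ _ _
  -- Later terms extend earlier ones, which turns squared distances into differences of traces and
  -- makes the sequence Cauchy.
  have hmul : ∀ m n, m ≤ n → star (v m).1 * (v n).1 = star (v m).1 * (v m).1 ∧
      (v n).1 * star (v m).1 = (v m).1 * star (v m).1 := by
    intro m n hmn
    induction n, hmn using Nat.le_induction with
    | base => exact ⟨rfl, rfl⟩
    | succ n hmn ih =>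
      obtain ⟨i1, i2⟩ := ih
      have j1 := hn1 (v n)
      have j2 := hn2 (v n)
      rw [← hvsucc] at j1 j2
      have hvs : star (v m).1 * (v m).1 * star (v m).1 = star (v m).1 := by
        simpa [mul_assoc] using congrArg star (v m).2.1
      have i1' : star (v n).1 * (v m).1 = star (v m).1 * (v m).1 := by
        simpa using congrArg star i1
      have i2' : (v m).1 * star (v n).1 = (v m).1 * star (v m).1 := by
        simpa using congrArg star i2
      constructor
      · calc star (v m).1 * (v (n + 1)).1
            = star (v m).1 * ((v m).1 * star (v m).1) * (v (n + 1)).1 := by rw [← mul_assoc, hvs]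
          _ = star (v m).1 * (v m).1 * (star (v n).1 * (v (n + 1)).1) := by
              rw [← i2']; simp only [mul_assoc]
          _ = star (v m).1 * ((v m).1 * star (v n).1) * (v n).1 := by
              rw [j1]; simp only [mul_assoc]
          _ = _ := by rw [i2', ← mul_assoc, hvs, i1]
      · calc (v (n + 1)).1 * star (v m).1
            = (v (n + 1)).1 * (star (v m).1 * (v m).1 * star (v m).1) := by rw [hvs]
          _ = ((v (n + 1)).1 * star (v n).1) * ((v m).1 * star (v m).1) := by
              rw [← i1']; simp only [mul_assoc]
          _ = (v n).1 * (star (v n).1 * (v m).1) * star (v m).1 := by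
              rw [j2]; simp only [mul_assoc]
          _ = _ := by rw [i1', mul_assoc, hvs, i2]
  let a : ℕ → ℝ := fun n => (τ (star (v n).1 * (v n).1)).re
  have hdist : ∀ m n, m ≤ n → ‖τ.toL2 (v n).1 - τ.toL2 (v m).1‖ ^ 2 = a n - a m := by
    intro m n hmn
    have h1 := (hmul m n hmn).1
    have h2 : star (v n).1 * (v m).1 = star (v m).1 * (v m).1 := by simpa using congrArg star h1
    rw [← map_sub, norm_toL2_sq, star_sub, sub_mul, mul_sub, mul_sub, h1, h2, sub_self, sub_zero,
      map_sub, Complex.sub_re]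
  have hamono : Monotone a := fun m n hmn => by
    have := hdist m n hmn
    have h2 := sq_nonneg ‖τ.toL2 (v n).1 - τ.toL2 (v m).1‖
    linarith
  have haf : ∀ n, a n ≤ (τ f).re := fun n => by
    have := τ.re_apply_projection_nonneg (hleft (v n))
    rw [map_sub, Complex.sub_re] at this
    exact sub_nonneg.mp this
  have hatend := tendsto_atTop_ciSup hamono ⟨(τ f).re, by rintro _ ⟨n, rfl⟩; exact haf n⟩
  have hcau : CauchySeq fun n => τ.toL2 (v n).1 := by
    have hcau := hatend.cauchySeq
    rw [Metric.cauchySeq_iff'] at hcau ⊢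
    intro ε hε
    obtain ⟨N, hN⟩ := hcau (ε ^ 2) (by positivity)
    refine ⟨N, fun n hn => ?_⟩
    have h2 := hN n hn
    rw [Real.dist_eq] at h2
    rw [dist_eq_norm]
    exact lt_of_pow_lt_pow_left₀ 2 hε.le
      ((hdist N n hn).le.trans_lt ((le_abs_self _).trans_lt h2))
  obtain ⟨w, hw⟩ := hτ (fun n => (v n).1)
    ⟨1, fun n => norm_le_one_of_partialIsometry (v n).2.1⟩ hcau
  have hgw : g * w = w := τ.toL2.injective (tendsto_nhds_unique (τ.tendsto_mul_left g hw)
    (by simpa only [(v _).2.2.1] using hw))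
  have hwf : w * f = w := τ.toL2.injective (tendsto_nhds_unique (τ.tendsto_mul_right f hw)
    (by simpa only [(v _).2.2.2] using hw))
  have hm1 : ∀ m, star (v m).1 * w = star (v m).1 * (v m).1 := fun m =>
    τ.toL2.injective (tendsto_nhds_unique (τ.tendsto_mul_left (star (v m).1) hw)
      (tendsto_const_nhds.congr' (by
        filter_upwards [eventually_ge_atTop m] with n hn
        rw [(hmul m n hn).1])))
  have hm2 : ∀ m, w * star (v m).1 = (v m).1 * star (v m).1 := fun m =>
    τ.toL2.injective (tendsto_nhds_unique (τ.tendsto_mul_right (star (v m).1) hw)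
      (tendsto_const_nhds.congr' (by
        filter_upwards [eventually_ge_atTop m] with n hn
        rw [(hmul m n hn).2])))
  have hpi : w * star w * w = w := by
    refine τ.toL2.injective (tendsto_nhds_unique
      (τ.tendsto_mul_right w (τ.tendsto_mul_left w (τ.tendsto_star hw))) ?_)
    have : ∀ m, w * star (v m).1 * w = (v m).1 := fun m => by
      rw [hm2, mul_assoc, hm1, ← mul_assoc, (v m).2.1]
    simpa only [this] using hw
  have halim : Tendsto a atTop (𝓝 (τ (star w * w)).re) := by
    have := hw.norm.pow 2
    simpa only [norm_toL2_sq] using this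
  -- The gains tend to `0`, so the product of the deficits of the limit is not positive. Both
  -- deficits are non-negative, hence one vanishes.
  have hprod : ((τ g).re - (τ (star w * w)).re) * ((τ f).re - (τ (star w * w)).re) ≤ 0 := by
    have h1 : Tendsto (fun n => ((τ g).re - a n) * ((τ f).re - a n) / 2) atTop
        (𝓝 (((τ g).re - (τ (star w * w)).re) * ((τ f).re - (τ (star w * w)).re) / 2)) :=
      ((halim.const_sub _).mul (halim.const_sub _)).div_const 2
    have h2 : Tendsto (fun n => a (n + 1) - a n) atTop (𝓝 0) := by
      simpa using (halim.comp (tendsto_add_atTop_nat 1)).sub halim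
    have := le_of_tendsto_of_tendsto' h1 h2 fun n => by
      have := hn3 (v n)
      rw [← hvsucc] at this
      exact this
    linarith
  have hl := hleft ⟨w, hpi, hgw, hwf⟩
  have hr := hright ⟨w, hpi, hgw, hwf⟩
  have hl0 := τ.re_apply_projection_nonneg hl
  have hr0 := τ.re_apply_projection_nonneg hr
  have el : (τ (f - star w * w)).re = (τ f).re - (τ (star w * w)).re := by simp
  have er : (τ (g - w * star w)).re = (τ g).re - (τ (star w * w)).re := by
    rw [τ.mul_comm _ w]; simp
  refine ⟨w, hgw, hwf, hpi, ?_⟩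
  simp only at hl hr hl0 hr0
  rw [el] at hl0
  rw [er] at hr0
  rcases eq_or_ne ((τ f).re - (τ (star w * w)).re) 0 with h | h
  · left
    exact (sub_eq_zero.mp (τ.eq_zero_of_nonneg hl.nonneg (el.trans h))).symm
  · right
    have : (τ g).re - (τ (star w * w)).re = 0 := by
      have : 0 < (τ f).re - (τ (star w * w)).re := lt_of_le_of_ne hl0 h.symm
      nlinarith
    exact (sub_eq_zero.mp (τ.eq_zero_of_nonneg hr.nonneg (er.trans this))).symm

/-- Any projection is a finite sum `∑ vᵢ vᵢ*` with the supports of the `vᵢ` below a given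
non-zero projection. -/
theorem Complete.exists_decomposition (hτ : τ.Complete) (hA : HasTrivialCenter A) (hτ1 : τ 1 = 1)
    {g f : A} (hg : IsStarProjection g) (hf : IsStarProjection f) (hf0 : f ≠ 0) :
    ∃ (k : ℕ) (v : Fin k → A), (∀ i, v i * f = v i) ∧ (∀ i, g * v i = v i) ∧
      ∑ i, v i * star (v i) = g := by
  have hpos : 0 < (τ f).re := lt_of_le_of_ne (τ.re_apply_projection_nonneg hf)
    fun h => hf0 (τ.eq_zero_of_nonneg hf.nonneg h.symm)
  obtain ⟨n, hn⟩ := exists_nat_ge ((τ g).re / (τ f).re)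
  rw [div_le_iff₀ hpos] at hn
  -- Here `τ(g) ≤ n τ(f)`. If `f` embeds in `g`, removing its copy lowers the trace by `τ(f)`;
  -- otherwise `g` embeds in `f` and one summand is enough.
  induction n generalizing g with
  | zero =>
    have : g = 0 := τ.eq_zero_of_nonneg hg.nonneg
      (le_antisymm (by simpa using hn) (τ.re_apply_projection_nonneg hg))
    exact ⟨0, Fin.elim0, fun i => i.elim0, fun i => i.elim0, by simp [this]⟩
  | succ n ih =>
    obtain ⟨w, hgw, hwf, hw, h | h⟩ := hτ.comparison hA hτ1 hg hf
    · have hproj : IsStarProjection (g - w * star w) := by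
        have h1 := isStarProjection_star_mul_self (w := star w)
          (by simpa [mul_assoc] using congrArg star hw)
        rw [star_star] at h1
        exact h1.sub_of_mul_eq_right hg (by rw [← mul_assoc, hgw])
      obtain ⟨k, v, hv1, hv2, hv3⟩ := ih hproj (by
        rw [map_sub, Complex.sub_re, τ.mul_comm, h]
        push_cast at hn
        linarith)
      refine ⟨k + 1, Fin.cons w v, fun i => ?_, fun i => ?_, ?_⟩
      · refine Fin.cases ?_ (fun i => ?_) i
        · simpa using hwf
        · simpa using hv1 i
      · refine Fin.cases ?_ (fun i => ?_) i
        · simpa using hgw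
        · simp only [Fin.cons_succ]
          rw [← hv2 i, ← mul_assoc, mul_sub, hg.isIdempotentElem.eq, ← mul_assoc, hgw]
      · rw [Fin.sum_univ_succ]
        simp only [Fin.cons_zero, Fin.cons_succ, hv3]
        abel
    · exact ⟨1, fun _ => w, fun _ => hwf, fun _ => hgw, by simpa using h⟩

end Comparison

end FaithfulTrace

end

/-! ### Matrices over the algebra and amplification of corner isomorphisms -/

noncomputable section

open Filter Topology

namespace FaithfulTrace

variable {A : Type*} [CStarAlgebra A] [PartialOrder A] [StarOrderedRing A] (τ : FaithfulTrace A)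

/-- The matrices over a C⋆-algebra. -/
abbrev Mat (k : ℕ) (A : Type*) := CStarMatrix (Fin k) (Fin k) A

omit [PartialOrder A] [StarOrderedRing A] in
theorem star_mul_self_apply_diag {k : ℕ} (X : Mat k A) (i : Fin k) :
    (star X * X) i i = ∑ j, star (X j i) * X j i := by
  rw [CStarMatrix.mul_apply]
  simp [CStarMatrix.star_apply]

/-- The trace `∑ᵢ τ(Xᵢᵢ)` of a matrix. -/
def matrix (k : ℕ) : FaithfulTrace (Mat k A) where
  toLin :=
    { toFun := fun X => ∑ i, τ (X i i)
      map_add' := fun X Y => by simp [Finset.sum_add_distrib]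
      map_smul' := fun c X => by simp [Finset.mul_sum] }
  nonneg' X := by
    simp only [LinearMap.coe_mk, AddHom.coe_mk, star_mul_self_apply_diag, map_sum]
    exact Finset.sum_nonneg fun i _ => Finset.sum_nonneg fun j _ => τ.nonneg _
  faithful' X h := by
    simp only [LinearMap.coe_mk, AddHom.coe_mk, star_mul_self_apply_diag, map_sum] at h
    rw [Finset.sum_eq_zero_iff_of_nonneg
      fun i _ => Finset.sum_nonneg fun j _ => τ.nonneg _] at h
    ext i j
    have h1 := h j (Finset.mem_univ j)
    rw [Finset.sum_eq_zero_iff_of_nonneg fun j _ => τ.nonneg _] at h1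
    exact τ.faithful' _ (h1 i (Finset.mem_univ i))
  tracial' X Y := by
    simp only [LinearMap.coe_mk, AddHom.coe_mk, CStarMatrix.mul_apply, map_sum]
    rw [Finset.sum_comm]
    simp only [τ.mul_comm]

omit [PartialOrder A] [StarOrderedRing A] in
theorem matrix_apply (k : ℕ) (X : Mat k A) : τ.matrix k X = ∑ i, τ (X i i) := rfl

theorem norm_toL2_matrix_sq {k : ℕ} (X : Mat k A) :
    ‖(τ.matrix k).toL2 X‖ ^ 2 = ∑ i, ∑ j, ‖τ.toL2 (X j i)‖ ^ 2 := by
  simp only [norm_toL2_sq, matrix_apply, star_mul_self_apply_diag, map_sum, Complex.re_sum]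

theorem norm_toL2_entry_le {k : ℕ} (X : Mat k A) (i j : Fin k) :
    ‖τ.toL2 (X j i)‖ ≤ ‖(τ.matrix k).toL2 X‖ := by
  rw [← pow_le_pow_iff_left₀ (norm_nonneg _) (norm_nonneg _) two_ne_zero, norm_toL2_matrix_sq]
  refine le_trans ?_ (Finset.single_le_sum (f := fun i => ∑ j, ‖τ.toL2 (X j i)‖ ^ 2)
    (fun i _ => Finset.sum_nonneg fun j _ => sq_nonneg _) (Finset.mem_univ i))
  exact Finset.single_le_sum (f := fun j => ‖τ.toL2 (X j i)‖ ^ 2)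
    (fun j _ => sq_nonneg _) (Finset.mem_univ j)

theorem norm_toL2_matrix_le {k : ℕ} (X : Mat k A) :
    ‖(τ.matrix k).toL2 X‖ ≤ ∑ i, ∑ j, ‖τ.toL2 (X j i)‖ := by
  have h0 : ∀ i : Fin k, 0 ≤ ∑ j, ‖τ.toL2 (X j i)‖ := fun i =>
    Finset.sum_nonneg fun j _ => norm_nonneg _
  rw [← pow_le_pow_iff_left₀ (norm_nonneg _) (Finset.sum_nonneg fun i _ => h0 i) two_ne_zero,
    norm_toL2_matrix_sq]
  refine (Finset.sum_le_sum fun i _ => ?_).trans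
    (Finset.sum_sq_le_sq_sum_of_nonneg (f := fun i => ∑ j, ‖τ.toL2 (X j i)‖) fun i _ => h0 i)
  exact Finset.sum_sq_le_sq_sum_of_nonneg fun j _ => norm_nonneg _

variable {τ}

theorem Complete.matrix (hτ : τ.Complete) (k : ℕ) : (τ.matrix k).Complete := by
  rintro X ⟨C, hC⟩ hX
  have h1 : ∀ i j, ∃ y, Tendsto (fun n => τ.toL2 (X n i j)) atTop (𝓝 (τ.toL2 y)) := by
    intro i j
    refine hτ _ ⟨C, fun n => CStarMatrix.norm_entry_le_norm.trans (hC n)⟩ ?_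
    rw [Metric.cauchySeq_iff'] at hX ⊢
    intro ε hε
    obtain ⟨N, hN⟩ := hX ε hε
    refine ⟨N, fun n hn => lt_of_le_of_lt ?_ (hN n hn)⟩
    rw [dist_eq_norm, dist_eq_norm, ← map_sub, ← map_sub]
    exact τ.norm_toL2_entry_le (X n - X N) j i
  choose Y hY using h1
  refine ⟨CStarMatrix.ofMatrix (Matrix.of Y), ?_⟩
  rw [tendsto_iff_norm_sub_tendsto_zero]
  have h2 : Tendsto (fun n => ∑ i, ∑ j, ‖τ.toL2 (X n j i) - τ.toL2 (Y j i)‖) atTop (𝓝 0) := by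
    have := tendsto_finsetSum (Finset.univ : Finset (Fin k)) fun i _ =>
      tendsto_finsetSum (Finset.univ : Finset (Fin k)) fun j _ =>
        tendsto_iff_norm_sub_tendsto_zero.mp (hY j i)
    simpa using this
  refine squeeze_zero (fun _ => norm_nonneg _) (fun n => ?_) h2
  rw [← map_sub]
  refine (τ.norm_toL2_matrix_le _).trans (le_of_eq ?_)
  simp only [← map_sub]
  rfl

end FaithfulTrace

namespace IsCornerEmbedding

section Compress

variable {N Q : Type*} [Ring N] [StarRing N] [Algebra ℂ N] [Ring Q] [StarRing Q] [Algebra ℂ Q]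
  {ι : N →⋆ₙₐ[ℂ] Q}

/-- The compression `a ↦ pap` to a corner. -/
def compress (hι : IsCornerEmbedding ι) : Q →ₗ[ℂ] N where
  toFun a := (hι.exists_eq a).choose
  map_add' a b := hι.injective <| by
    rw [map_add, (hι.exists_eq _).choose_spec, (hι.exists_eq a).choose_spec,
      (hι.exists_eq b).choose_spec, mul_add, add_mul]
  map_smul' c a := hι.injective <| by
    rw [map_smul, (hι.exists_eq _).choose_spec, (hι.exists_eq a).choose_spec]
    simp

theorem apply_compress (hι : IsCornerEmbedding ι) (a : Q) :
    ι (hι.compress a) = ι 1 * a * ι 1 := (hι.exists_eq a).choose_spec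

theorem apply_compress_of_eq (hι : IsCornerEmbedding ι) {a : Q} (h1 : ι 1 * a = a)
    (h2 : a * ι 1 = a) : ι (hι.compress a) = a := by rw [apply_compress, h1, h2]

theorem compress_star (hι : IsCornerEmbedding ι) (a : Q) :
    hι.compress (star a) = star (hι.compress a) := hι.injective <| by
  rw [map_star ι, apply_compress, apply_compress]
  simp [star_one, mul_assoc]

end Compress

section Amplify

variable {N N₁ A : Type*} [CStarAlgebra N] [CStarAlgebra N₁] [CStarAlgebra A] [PartialOrder A]
  [StarOrderedRing A] {ι : N →⋆ₙₐ[ℂ] A} {ι₁ ψ : N₁ →⋆ₙₐ[ℂ] A}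

open FaithfulTrace

-- Compression is not multiplicative in general; it is here because `v` and `w*` absorb the
-- projection `ι₁ 1` between the two factors.
omit [PartialOrder A] [StarOrderedRing A] in
theorem compress_mul_compress (hι₁ : IsCornerEmbedding ι₁) {v w : A} (hv : v * ι₁ 1 = v)
    (hw : w * ι₁ 1 = w) (a b : A) :
    hι₁.compress (a * v) * hι₁.compress (star w * b) = hι₁.compress (a * v * star w * b) := by
  have hw' : ι₁ 1 * star w = star w := by simpa [star_one] using congrArg star hw
  refine hι₁.injective ?_
  rw [map_mul, apply_compress, apply_compress, apply_compress]
  calc ι₁ 1 * (a * v) * ι₁ 1 * (ι₁ 1 * (star w * b) * ι₁ 1)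
      = ι₁ 1 * a * (v * ι₁ 1) * (ι₁ 1 * star w) * b * ι₁ 1 := by noncomm_ring
    _ = _ := by rw [hv, hw']; noncomm_ring

/-- The homomorphism `x ↦ [ψ(vᵢ* x vⱼ)]` into the matrices. -/
def amplify (ι : N →⋆ₙₐ[ℂ] A) (hι₁ : IsCornerEmbedding ι₁) (ψ : N₁ →⋆ₙₐ[ℂ] A) {k : ℕ}
    (v : Fin k → A) (hv : ∀ i, v i * ι₁ 1 = v i) (hsum : ∑ i, v i * star (v i) = ι 1) :
    N →⋆ₙₐ[ℂ] Mat k A where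
  toFun x := CStarMatrix.ofMatrix
    (Matrix.of fun i j => ψ (hι₁.compress (star (v i) * ι x * v j)))
  map_smul' c x := by
    ext i j
    simp [CStarMatrix.ofMatrix_apply]
  map_zero' := by
    ext i j
    simp [CStarMatrix.ofMatrix_apply]
  map_add' x y := by
    ext i j
    simp [CStarMatrix.ofMatrix_apply, mul_add, add_mul]
  map_mul' x y := by
    ext i j
    rw [CStarMatrix.mul_apply]
    simp only [CStarMatrix.ofMatrix_apply, Matrix.of_apply]
    simp only [← map_mul, mul_assoc (star (v _)) (ι y) (v j),
      hι₁.compress_mul_compress (hv _) (hv _)]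
    rw [← map_sum, ← map_sum]
    congr 2
    -- Inserting `∑ vₐ vₐ* = ι 1` between `x` and `y` produces the matrix product.
    calc star (v i) * ι (x * y) * v j = star (v i) * ι x * (∑ a, v a * star (v a)) * (ι y * v j) := by
          rw [hsum, map_mul, mul_assoc _ (ι x), apply_mul_one]; noncomm_ring
      _ = _ := by
          rw [Finset.mul_sum, Finset.sum_mul]
          simp only [mul_assoc]
  map_star' x := by
    ext i j
    rw [CStarMatrix.star_apply]
    simp only [CStarMatrix.ofMatrix_apply, Matrix.of_apply]
    rw [← map_star, ← compress_star]
    simp [mul_assoc, map_star]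

omit [PartialOrder A] [StarOrderedRing A] in
theorem amplify_apply (hι₁ : IsCornerEmbedding ι₁) {k : ℕ}
    (v : Fin k → A) (hv : ∀ i, v i * ι₁ 1 = v i) (hsum : ∑ i, v i * star (v i) = ι 1)
    (x : N) (i j : Fin k) : amplify ι hι₁ ψ v hv hsum x i j =
      ψ (hι₁.compress (star (v i) * ι x * v j)) := rfl

omit [PartialOrder A] [StarOrderedRing A] in
theorem amplify_isCornerEmbedding (hι : IsCornerEmbedding ι) (hι₁ : IsCornerEmbedding ι₁)
    (hψ : IsCornerEmbedding ψ) {k : ℕ} (v : Fin k → A) (hv : ∀ i, v i * ι₁ 1 = v i)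
    (hpv : ∀ i, ι 1 * v i = v i) (hsum : ∑ i, v i * star (v i) = ι 1) :
    IsCornerEmbedding (amplify ι hι₁ ψ v hv hsum) where
  injective := by
    rw [injective_iff_map_eq_zero]
    intro x hx
    have h1 : ∀ i j, star (v i) * ι x * v j = 0 := by
      intro i j
      have h2 : amplify ι hι₁ ψ v hv hsum x i j = 0 := by rw [hx]; rfl
      rw [amplify_apply] at h2
      have h3 := congrArg ι₁ (hψ.injective (h2.trans (map_zero ψ).symm))
      rw [map_zero, hι₁.apply_compress_of_eq ?_ (by rw [mul_assoc, hv])] at h3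
      · exact h3
      · have : ι₁ 1 * star (v i) = star (v i) := by simpa [star_one] using congrArg star (hv i)
        rw [← mul_assoc, ← mul_assoc, this]
    refine hι.injective ?_
    have h2 : ι x = ι 1 * ι x * ι 1 := by rw [one_mul_apply, apply_mul_one]
    rw [map_zero ι, h2, ← hsum, Finset.sum_mul, Finset.sum_mul]
    refine Finset.sum_eq_zero fun i _ => ?_
    rw [Finset.mul_sum]
    refine Finset.sum_eq_zero fun j _ => ?_
    calc v i * star (v i) * ι x * (v j * star (v j))
        = v i * (star (v i) * ι x * v j) * star (v j) := by noncomm_ring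
      _ = 0 := by rw [h1]; simp
  exists_eq X := by
    -- The inverse pulls each entry of `X` back through `ψ` and reassembles it as `∑ v_b (·) v_c*`.
    refine ⟨hι.compress (∑ b, ∑ c, v b * ι₁ (hψ.compress (X b c)) * star (v c)), ?_⟩
    have hp : ι (hι.compress (∑ b, ∑ c, v b * ι₁ (hψ.compress (X b c)) * star (v c))) =
        ∑ b, ∑ c, v b * ι₁ (hψ.compress (X b c)) * star (v c) := by
      have hvp : ∀ i, star (v i) * ι 1 = star (v i) := fun i => by
        simpa [star_one] using congrArg star (hpv i)
      refine hι.apply_compress_of_eq ?_ ?_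
      · simp only [Finset.mul_sum, ← mul_assoc, hpv]
      · simp only [Finset.sum_mul, mul_assoc, hvp]
    ext a d
    have hψX : ∀ (y z : N₁) b c, ψ y * X b c * ψ z = ψ (y * hψ.compress (X b c) * z) := by
      intro y z b c
      calc ψ y * X b c * ψ z = ψ y * ψ 1 * X b c * (ψ 1 * ψ z) := by
            rw [apply_mul_one, one_mul_apply]
        _ = _ := by rw [map_mul, map_mul, apply_compress]; simp only [mul_assoc]
    rw [CStarMatrix.mul_apply]
    simp only [CStarMatrix.mul_apply, Finset.sum_mul, amplify_apply, hψX]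
    rw [hp, Finset.sum_comm]
    simp only [← map_sum]
    congr 1
    refine hι₁.injective ?_
    have hf : ∀ i, ι₁ 1 * star (v i) = star (v i) := fun i => by
      simpa [star_one] using congrArg star (hv i)
    rw [apply_compress]
    simp only [map_sum, map_mul, apply_compress, Finset.mul_sum, Finset.sum_mul]
    refine Finset.sum_congr rfl fun c _ => Finset.sum_congr rfl fun b _ => ?_
    set Y := ι₁ (hψ.compress (X b c))
    calc ι₁ 1 * (star (v a) * (v b * Y * star (v c)) * v d) * ι₁ 1
        = ι₁ 1 * star (v a) * (v b * Y * star (v c)) * (v d * ι₁ 1) := by noncomm_ring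
      _ = ι₁ 1 * star (v a) * (ι 1 * v b * ι₁ 1) * Y * (ι₁ 1 * star (v c) * (ι 1 * v d) * ι₁ 1) := by
          simp only [hpv, hf, hv]
          rw [mul_assoc _ (v d), hv]
          noncomm_ring
      _ = _ := by simp only [mul_assoc]

/-- On `N₁` the functionals `τ ∘ ψ` and `τ ∘ ι₁` are complete traces, hence proportional; then `∑
τ(vᵢ* x vᵢ) = τ(∑ vᵢ vᵢ* x) = τ(x)`. -/
theorem amplify_trace (hι₁ : IsCornerEmbedding ι₁)
    (hψ : IsCornerEmbedding ψ) {k : ℕ} (v : Fin k → A) (hv : ∀ i, v i * ι₁ 1 = v i)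
    (hsum : ∑ i, v i * star (v i) = ι 1) {τ : FaithfulTrace A} (hτ : τ.Complete)
    (hA : HasTrivialCenter A) (x : N) :
    τ.matrix k (amplify ι hι₁ ψ v hv hsum x) * τ (ι₁ 1) = τ (ψ 1) * τ (ι x) := by
  let _ := CStarAlgebra.spectralOrder N₁
  have := CStarAlgebra.spectralOrderedRing N₁
  have key : ∀ y, τ (ψ y) * τ (ι₁ 1) = τ (ι₁ y) * τ (ψ 1) := fun y =>
    hι₁.apply_mul_apply_one hτ hA (hψ.complete_comap hτ) y
  have hf : ∀ i, ι₁ 1 * star (v i) = star (v i) := fun i => by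
    simpa [star_one] using congrArg star (hv i)
  rw [matrix_apply, Finset.sum_mul]
  have h1 : ∀ i, τ (amplify ι hι₁ ψ v hv hsum x i i) * τ (ι₁ 1) =
      τ (v i * star (v i) * ι x) * τ (ψ 1) := by
    intro i
    rw [amplify_apply, key, hι₁.apply_compress_of_eq (by rw [← mul_assoc, ← mul_assoc, hf])
      (by rw [mul_assoc, hv]), τ.mul_comm, mul_assoc]
  rw [Finset.sum_congr rfl fun i _ => h1 i, ← Finset.sum_mul, ← map_sum, ← Finset.sum_mul, hsum,
    one_mul_apply, _root_.mul_comm]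

end Amplify

end IsCornerEmbedding

end

/-! ### Intertwiners, and the completely positive map between two corner embeddings -/

noncomputable section

open Filter Topology

namespace IsCornerEmbedding

open FaithfulTrace

variable {N Q : Type*} [CStarAlgebra N] [CStarAlgebra Q]
  {θ₁ θ₂ : N →⋆ₙₐ[ℂ] Q} {τ : FaithfulTrace Q} {σ : FaithfulTrace N} {t₁ t₂ : ℝ}

theorem apply_mul_star_apply (θ : N →⋆ₙₐ[ℂ] Q) {u : N} (hu : u ∈ unitary N) :
    θ u * star (θ u) = θ 1 := by
  rw [← map_star, ← map_mul, Unitary.mul_star_self_of_mem hu]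

theorem star_apply_mul_apply (θ : N →⋆ₙₐ[ℂ] Q) {u : N} (hu : u ∈ unitary N) :
    star (θ u) * θ u = θ 1 := by
  rw [← map_star, ← map_mul, Unitary.star_mul_self_of_mem hu]

theorem star_one_mul_one (θ : N →⋆ₙₐ[ℂ] Q) : star (θ 1) * θ 1 = θ 1 := by
  rw [star_one, one_mul_apply]

/-- Two corner embeddings that are uniformly close on the unitaries of `B` are intertwined by a
non-zero element. -/
theorem exists_intertwiner (hτ : τ.Complete) (B : StarSubalgebra ℂ N)
    (hB : ∀ b ∈ B, b ∈ Submodule.span ℂ {u : N | u ∈ B ∧ u ∈ unitary N}) {c : ℝ}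
    (hclose : ∀ u ∈ B, u ∈ unitary N → ‖τ.toL2 (θ₁ u - θ₂ u)‖ ≤ c)
    (hc : c < ‖τ.toL2 (θ₂ 1)‖) :
    ∃ v : Q, v ≠ 0 ∧ θ₁ 1 * v = v ∧ v * θ₂ 1 = v ∧ ∀ b ∈ B, θ₁ b * v = v * θ₂ b := by
  let U : Type _ := {u : N // u ∈ B ∧ u ∈ unitary N}
  have hone : (1 : N) ∈ B ∧ (1 : N) ∈ unitary N := ⟨one_mem _, one_mem _⟩
  let S : Set Q := Set.range fun u : U => θ₁ u.1 * star (θ₂ u.1)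
  let T : Q →ₗ[ℝ] τ.L2 := (τ.toL2 : Q →ₗ[ℂ] τ.L2).restrictScalars ℝ
  have hn1 : ∀ (θ : N →⋆ₙₐ[ℂ] Q) (u : U), ‖θ u.1‖ ≤ 1 := fun θ u =>
    norm_le_one_of_partialIsometry (by rw [apply_mul_star_apply θ u.2.2, one_mul_apply])
  have hbd : ∀ y ∈ convexHull ℝ S, ‖y‖ ≤ 1 := by
    intro y hy
    have : convexHull ℝ S ⊆ Metric.closedBall 0 1 := by
      refine convexHull_min ?_ (convex_closedBall _ _)
      rintro _ ⟨u, rfl⟩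
      rw [mem_closedBall_zero_iff]
      refine (norm_mul_le _ _).trans ?_
      rw [norm_star]
      exact mul_le_one₀ (hn1 θ₁ u) (norm_nonneg _) (hn1 θ₂ u)
    simpa using this hy
  -- `θ₁(u) θ₂(u)* - θ₂(1) = (θ₁(u) - θ₂(u)) θ₂(u)*` has norm at most `c < ‖θ₂(1)‖₂`, so the closed
  -- hull avoids `0`.
  have hnear : ∀ y ∈ T '' convexHull ℝ S, y ∈ Metric.closedBall (τ.toL2 (θ₂ 1)) c := by
    rw [T.image_convexHull]
    refine fun y hy => convexHull_min ?_ (convex_closedBall _ _) hy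
    rintro _ ⟨_, ⟨u, rfl⟩, rfl⟩
    rw [mem_closedBall_iff_norm]
    change ‖τ.toL2 _ - _‖ ≤ c
    rw [← map_sub, ← apply_mul_star_apply θ₂ u.2.2, ← sub_mul]
    refine (τ.norm_toL2_mul_le_of_proj (p := θ₂ 1) ?_ (star_one_mul_one θ₂)).trans
      (hclose _ u.2.1 u.2.2)
    rw [star_star, star_apply_mul_apply θ₂ u.2.2]
  obtain ⟨v, hv, hfix⟩ := exists_fixed_mem_closure (K := T '' convexHull ℝ S)
    (((show S.Nonempty from ⟨_, ⟨⟨1, hone⟩, rfl⟩⟩).convexHull).image _)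
    ((convex_convexHull ℝ S).linear_image T)
    (fun z hz hcau => by
      choose w hw hwz using hz
      obtain rfl : (fun n => τ.toL2 (w n)) = z := funext hwz
      obtain ⟨y, hy⟩ := hτ w ⟨1, fun n => hbd _ (hw n)⟩ hcau
      exact ⟨_, hy⟩)
    (fun u : U => τ.toL2.toLinearMap ∘ₗ (LinearMap.mulRight ℂ (star (θ₂ u.1)) ∘ₗ
      LinearMap.mulLeft ℂ (θ₁ u.1)) ∘ₗ τ.toL2.symm.toLinearMap)
    (fun u z => by
      obtain ⟨z, rfl⟩ := τ.toL2.surjective z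
      simp only [LinearMap.comp_apply, LinearEquiv.coe_coe, LinearEquiv.symm_apply_apply,
        LinearMap.mulLeft_apply, LinearMap.mulRight_apply]
      exact (τ.norm_toL2_mul_le_of_proj (p := θ₂ 1)
        (by rw [star_star, star_apply_mul_apply θ₂ u.2.2]) (star_one_mul_one _)).trans
        (τ.norm_toL2_mul_le_of_proj_left (p := θ₁ 1) (star_apply_mul_apply θ₁ u.2.2)
          (star_one_mul_one _)))
    (by
      rintro u _ ⟨z, hz, rfl⟩
      -- The map of `u` sends the generator of `w` to the generator of `uw`, so it preserves the
      -- hull.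
      refine ⟨θ₁ u.1 * z * star (θ₂ u.1), ?_, rfl⟩
      let f : Q →ₗ[ℝ] Q :=
        (LinearMap.mulRight ℝ (star (θ₂ u.1))).comp (LinearMap.mulLeft ℝ (θ₁ u.1))
      have : f '' (convexHull ℝ S) ⊆ convexHull ℝ S := by
        rw [f.image_convexHull]
        refine convexHull_mono ?_
        rintro _ ⟨_, ⟨w, rfl⟩, rfl⟩
        exact ⟨⟨u.1 * w.1, mul_mem u.2.1 w.2.1, mul_mem u.2.2 w.2.2⟩, by simp [f, mul_assoc]⟩
      exact this ⟨z, hz, rfl⟩)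
  have hv2 : v ∈ Metric.closedBall (τ.toL2 (θ₂ 1)) c :=
    closure_minimal hnear Metric.isClosed_closedBall hv
  obtain ⟨v, rfl⟩ := τ.toL2.surjective v
  have hfix' : ∀ u ∈ B, u ∈ unitary N → θ₁ u * v * star (θ₂ u) = v := fun u hu hu' =>
    τ.toL2.injective (hfix ⟨u, hu, hu'⟩)
  have h1 := hfix' 1 hone.1 hone.2
  have hl : θ₁ 1 * v = v := by
    rw [← h1, ← mul_assoc, ← mul_assoc, one_mul_apply]
  have hr : v * θ₂ 1 = v := by
    rw [← h1, star_one, mul_assoc, one_mul_apply]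
  refine ⟨v, ?_, hl, hr, fun b hb => ?_⟩
  · rintro rfl
    rw [mem_closedBall_iff_norm, ← map_sub, zero_sub, map_neg, norm_neg] at hv2
    linarith
  · have hb' := hB b hb
    clear hb
    induction hb' using Submodule.span_induction with
    | mem u hu =>
      conv_rhs => rw [← hfix' u hu.1 hu.2]
      rw [mul_assoc, star_apply_mul_apply θ₂ hu.2, mul_assoc, hr]
    | zero => simp
    | add a b _ _ ha hb => rw [map_add, map_add, add_mul, mul_add, ha, hb]
    | smul r a _ ha => rw [map_smul, map_smul, smul_mul_assoc, mul_smul_comm, ha]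

/-- Intertwined corner embeddings scale the trace by the same factor, if `B' ∩ N ⊆ B`. -/
theorem eq_of_exists_intertwiner (hθ₁ : IsCornerEmbedding θ₁) (hθ₂ : IsCornerEmbedding θ₂)
    (h₁ : ∀ x, τ (θ₁ x) = t₁ * σ x) (h₂ : ∀ x, τ (θ₂ x) = t₂ * σ x) (B : StarSubalgebra ℂ N)
    (hcomm : ∀ y, (∀ b ∈ B, b * y = y * b) → y ∈ B)
    {v : Q} (hv0 : v ≠ 0) (hl : θ₁ 1 * v = v) (hr : v * θ₂ 1 = v)
    (hv : ∀ b ∈ B, θ₁ b * v = v * θ₂ b) : t₁ = t₂ := by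
  have hl' : star v * θ₁ 1 = star v := by simpa [star_one] using congrArg star hl
  have hr' : θ₂ 1 * star v = star v := by simpa [star_one] using congrArg star hr
  have hv' : ∀ b ∈ B, star v * θ₁ b = θ₂ b * star v := fun b hb => by
    simpa [map_star] using congrArg star (hv (star b) (star_mem hb))
  obtain ⟨y, hy⟩ : ∃ y, θ₂ y = star v * v := by
    obtain ⟨y, hy⟩ := hθ₂.exists_eq (star v * v)
    exact ⟨y, by rw [hy, mul_assoc, mul_assoc, hr, ← mul_assoc, hr']⟩
  obtain ⟨z, hz⟩ : ∃ z, θ₁ z = v * star v := by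
    obtain ⟨z, hz⟩ := hθ₁.exists_eq (v * star v)
    exact ⟨z, by rw [hz, mul_assoc, mul_assoc, hl', ← mul_assoc, hl]⟩
  -- `v*v` commutes with `θ₂(B)` and `vv*` with `θ₁(B)`, so `y` and `z` lie in `B' ∩ N ⊆ B`.
  have hyB : y ∈ B := hcomm y fun b hb => hθ₂.injective <| by
    rw [map_mul, map_mul, hy, ← mul_assoc, ← hv' b hb, mul_assoc, hv b hb, ← mul_assoc]
  have hzcomm : ∀ b ∈ B, b * z = z * b := fun b hb => hθ₁.injective <| by
    rw [map_mul, map_mul, hz, ← mul_assoc, hv b hb, mul_assoc, ← hv' b hb, ← mul_assoc]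
  have hzB : z ∈ B := hcomm z hzcomm
  -- As `y` and `z` belong to `B`, the intertwining relation applies to them: `z² = yz = y²`, and
  -- then `(y - z)² = 0`.
  have e1 : z * z = y * z := hθ₁.injective <| by
    rw [map_mul, map_mul, hz, ← mul_assoc, ← mul_assoc, hv y hyB, hy]
    simp only [mul_assoc]
  have e2 : y * y = y * z := hθ₂.injective <| by
    rw [map_mul, map_mul, hy, mul_assoc (star v) v (θ₂ z), ← hv z hzB, hz]
    simp only [mul_assoc]
  have e3 : y * z = z * y := hzcomm y hyB
  have hys : star y = y := hθ₂.injective (by rw [map_star, hy]; simp)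
  have hzs : star z = z := hθ₁.injective (by rw [map_star, hz]; simp)
  have hyz : y = z := by
    rw [← sub_eq_zero, ← CStarRing.star_mul_self_eq_zero_iff, star_sub, hys, hzs, sub_mul, mul_sub,
      mul_sub, ← e3, e1, e2]
    abel
  have h3 : (t₁ : ℂ) * σ z = t₂ * σ z := by
    rw [← h₁, hz, τ.mul_comm, ← hy, h₂, hyz]
  have hz0 : σ z ≠ 0 := by
    intro h0
    apply hv0
    have h4 := h₂ y
    rw [hy, hyz, h0, mul_zero] at h4
    exact τ.faithful' _ h4
  exact_mod_cast mul_right_cancel₀ hz0 h3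

section CPMap

theorem exists_eq_star_mul_self {A : Type*} [CStarAlgebra A] [PartialOrder A] [StarOrderedRing A]
    {x : A} (hx : 0 ≤ x) : ∃ d, x = star d * d :=
  CStarAlgebra.nonneg_iff_eq_star_mul_self.mp hx

/-- The map `θ₂⁻¹ ∘ (p₂ · p₂) ∘ θ₁`. -/
def transfer (θ₁ : N →⋆ₙₐ[ℂ] Q) (hθ₂ : IsCornerEmbedding θ₂) : N →ₗ[ℂ] N :=
  hθ₂.compress ∘ₗ (θ₁ : N →ₗ[ℂ] Q)

theorem apply_transfer (θ₁ : N →⋆ₙₐ[ℂ] Q) (hθ₂ : IsCornerEmbedding θ₂) (x : N) :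
    θ₂ (transfer θ₁ hθ₂ x) = θ₂ 1 * θ₁ x * θ₂ 1 := hθ₂.apply_compress _

theorem transfer_star (θ₁ : N →⋆ₙₐ[ℂ] Q) (hθ₂ : IsCornerEmbedding θ₂) (x : N) :
    transfer θ₁ hθ₂ (star x) = star (transfer θ₁ hθ₂ x) := hθ₂.injective <| by
  rw [apply_transfer, map_star, map_star, apply_transfer]
  simp [star_one, mul_assoc]

/-- Tested with the trace, `1 - φ(1)` yields `‖θ₂(a)‖₂² - ‖θ₁(1) θ₂(a)‖₂²` up to the factor `t₂`,
and projections contract. -/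
theorem transfer_one_le [PartialOrder N] [StarOrderedRing N] (hθ₂ : IsCornerEmbedding θ₂)
    (ht₂ : 0 < t₂) (h₂ : ∀ x, τ (θ₂ x) = t₂ * σ x) : transfer θ₁ hθ₂ 1 ≤ 1 := by
  rw [← sub_nonneg]
  refine σ.nonneg_of_forall ?_ fun a => ?_
  · rw [IsSelfAdjoint, star_sub, ← transfer_star, _root_.star_one]
  · have h := congrArg Complex.re (h₂ (star a * (1 - transfer θ₁ hθ₂ 1) * a))
    rw [Complex.re_ofReal_mul] at h
    refine nonneg_of_mul_nonneg_right (le_of_le_of_eq ?_ h) ht₂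
    have e : θ₂ (star a * (1 - transfer θ₁ hθ₂ 1) * a) =
        star (θ₂ a) * θ₂ a - star (θ₁ 1 * θ₂ a) * (θ₁ 1 * θ₂ a) := by
      rw [map_mul, map_mul, map_sub, apply_transfer, star_mul, star_one, map_star, mul_sub, sub_mul]
      have h1 : star (θ₂ a) * θ₂ 1 = star (θ₂ a) := by rw [← map_star, apply_mul_one]
      congr 1
      · rw [h1]
      · calc _ = star (θ₂ a) * θ₂ 1 * θ₁ 1 * (θ₂ 1 * θ₂ a) := by noncomm_ring
          _ = star (θ₂ a) * (θ₁ 1 * θ₁ 1) * θ₂ a := by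
            rw [h1, one_mul_apply, one_mul_apply]
          _ = _ := by noncomm_ring
    rw [e, map_sub, Complex.sub_re, ← norm_toL2_sq, ← norm_toL2_sq, sub_nonneg]
    gcongr
    exact τ.norm_toL2_mul_le_of_proj_left (star_one_mul_one θ₁) (star_one_mul_one θ₁)

theorem norm_toL2_scale (ht₂ : 0 ≤ t₂) (h₂ : ∀ x, τ (θ₂ x) = t₂ * σ x) (x : N) :
    ‖τ.toL2 (θ₂ x)‖ = √t₂ * ‖σ.toL2 x‖ := by
  rw [← sq_eq_sq₀ (norm_nonneg _) (by positivity), mul_pow, Real.sq_sqrt ht₂, norm_toL2_sq,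
    norm_toL2_sq, ← map_star, ← map_mul, h₂, Complex.re_ofReal_mul]

/-- `t₂ σ(φ(x*x)) = ‖θ₁(x) p₂‖₂² ≤ ‖θ₁(x)‖₂² = t₁ ‖x‖₂²`. This is where the order of the two scales
matters. -/
theorem apply_transfer_le (hθ₂ : IsCornerEmbedding θ₂) (ht₂ : 0 < t₂) (h12 : t₁ ≤ t₂)
    (h₁ : ∀ x, τ (θ₁ x) = t₁ * σ x) (h₂ : ∀ x, τ (θ₂ x) = t₂ * σ x) (x : N) :
    σ (transfer θ₁ hθ₂ (star x * x)) ≤ σ (star x * x) := by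
  have h3 : τ (θ₂ (transfer θ₁ hθ₂ (star x * x))) = (‖τ.toL2 (θ₁ x * θ₂ 1)‖ ^ 2 : ℝ) := by
    rw [← apply_star_mul_self, apply_transfer, map_mul θ₁, map_star θ₁, star_mul, star_one]
    simp only [mul_assoc]
  rw [h₂] at h3
  have h4 : ‖τ.toL2 (θ₁ x * θ₂ 1)‖ ^ 2 ≤ ‖τ.toL2 (θ₁ x)‖ ^ 2 := by
    gcongr
    exact τ.norm_toL2_mul_le_of_proj (p := θ₂ 1) (by rw [star_one, one_mul_apply])
      (star_one_mul_one θ₂)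
  have h5 : ‖τ.toL2 (θ₁ x)‖ ^ 2 = t₁ * ‖σ.toL2 x‖ ^ 2 := by
    rw [norm_toL2_sq, norm_toL2_sq, ← map_star, ← map_mul, h₁, Complex.re_ofReal_mul]
  have h6 : ‖τ.toL2 (θ₁ x * θ₂ 1)‖ ^ 2 / t₂ ≤ ‖σ.toL2 x‖ ^ 2 := by
    rw [div_le_iff₀ ht₂]
    nlinarith [sq_nonneg ‖σ.toL2 x‖]
  have h7 : σ (transfer θ₁ hθ₂ (star x * x)) = ((‖τ.toL2 (θ₁ x * θ₂ 1)‖ ^ 2 / t₂ : ℝ) : ℂ) := by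
    have : (t₂ : ℂ) ≠ 0 := Complex.ofReal_ne_zero.mpr ht₂.ne'
    rw [Complex.ofReal_div, ← h3, mul_div_cancel_left₀ _ this]
  rw [h7, apply_star_mul_self]
  exact Complex.real_le_real.mpr h6

theorem norm_toL2_transfer_sub_le (hθ₂ : IsCornerEmbedding θ₂) (ht₂ : 0 < t₂)
    (h₂ : ∀ x, τ (θ₂ x) = t₂ * σ x) (x : N) :
    √t₂ * ‖σ.toL2 (transfer θ₁ hθ₂ x - x)‖ ≤ ‖τ.toL2 (θ₁ x - θ₂ x)‖ := by
  rw [← norm_toL2_scale ht₂.le h₂, map_sub, apply_transfer]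
  have e : θ₂ 1 * θ₁ x * θ₂ 1 - θ₂ x = θ₂ 1 * (θ₁ x - θ₂ x) * θ₂ 1 := by
    rw [mul_sub, sub_mul, one_mul_apply, apply_mul_one]
  rw [e]
  exact (τ.norm_toL2_mul_le_of_proj (p := θ₂ 1) (by rw [star_one, one_mul_apply])
    (star_one_mul_one θ₂)).trans (τ.norm_toL2_mul_le_of_proj_left (star_one_mul_one θ₂)
    (star_one_mul_one θ₂))

/-- With `pᵢ = θᵢ(1)`, the difference splits as `(p₁ - p₂) θ₁(u) + p₂ θ₁(u) (p₁ - p₂) + (p₂ θ₁(u) p₂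
- θ₂(u))`. Rigidity controls the last term; the others require closeness at `1`. -/
theorem norm_toL2_sub_le (hθ₂ : IsCornerEmbedding θ₂) (ht₂ : 0 < t₂)
    (h₂ : ∀ x, τ (θ₂ x) = t₂ * σ x) {u : N} (hu : u ∈ unitary N) :
    ‖τ.toL2 (θ₁ u - θ₂ u)‖ ≤
      2 * ‖τ.toL2 (θ₁ 1 - θ₂ 1)‖ + √t₂ * ‖σ.toL2 (transfer θ₁ hθ₂ u - u)‖ := by
  rw [← norm_toL2_scale ht₂.le h₂, map_sub θ₂, apply_transfer]
  have e : θ₁ u - θ₂ u = (θ₁ 1 - θ₂ 1) * θ₁ u + θ₂ 1 * (θ₁ u * (θ₁ 1 - θ₂ 1)) +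
      (θ₂ 1 * θ₁ u * θ₂ 1 - θ₂ u) := by
    rw [sub_mul, mul_sub, one_mul_apply, apply_mul_one]; noncomm_ring
  have i1 : ‖τ.toL2 ((θ₁ 1 - θ₂ 1) * θ₁ u)‖ ≤ ‖τ.toL2 (θ₁ 1 - θ₂ 1)‖ :=
    τ.norm_toL2_mul_le_of_proj (apply_mul_star_apply θ₁ hu) (star_one_mul_one θ₁)
  have i2 : ‖τ.toL2 (θ₂ 1 * (θ₁ u * (θ₁ 1 - θ₂ 1)))‖ ≤ ‖τ.toL2 (θ₁ 1 - θ₂ 1)‖ :=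
    (τ.norm_toL2_mul_le_of_proj_left (star_one_mul_one θ₂) (star_one_mul_one θ₂)).trans
      (τ.norm_toL2_mul_le_of_proj_left (star_apply_mul_apply θ₁ hu) (star_one_mul_one θ₁))
  rw [e, map_add, map_add]
  refine (norm_add_le _ _).trans (add_le_add_left ((norm_add_le _ _).trans ?_) _)
  linarith

/-- Positivity is tested by the matrix trace: after applying `θ₂`, the diagonal of `a* Z a` becomes
a sum of squares `X* X` with `X = ∑ θ₁(C) θ₂(a)`. The factor `D` comes from positivity in the
C⋆-algebra of matrices. -/
theorem transfer_completelyPositive [PartialOrder N] [StarOrderedRing N]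
    (hθ₂ : IsCornerEmbedding θ₂) (ht₂ : 0 < t₂) (h₂ : ∀ x, τ (θ₂ x) = t₂ * σ x) (n : ℕ)
    (C : Matrix (Fin n) (Fin n) N) :
    ∃ D : Matrix (Fin n) (Fin n) N, (Cᴴ * C).map (transfer θ₁ hθ₂) = Dᴴ * D := by
  let Z : Mat n N := CStarMatrix.ofMatrix ((Cᴴ * C).map (transfer θ₁ hθ₂))
  have hZ : ∀ i j, Z i j = transfer θ₁ hθ₂ (∑ c, star (C c i) * C c j) := fun i j => rfl
  have hpos : 0 ≤ Z := by
    refine (σ.matrix n).nonneg_of_forall ?_ fun a => ?_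
    · change star Z = Z
      ext i j
      rw [CStarMatrix.star_apply, hZ, hZ, ← transfer_star]
      simp
    · refine nonneg_of_mul_nonneg_right (a := t₂) ?_ ht₂
      rw [← Complex.re_ofReal_mul, matrix_apply, Finset.mul_sum, Complex.re_sum]
      refine Finset.sum_nonneg fun i _ => ?_
      rw [← h₂]
      have e : θ₂ ((star a * Z * a) i i) = ∑ c, star (∑ x, θ₁ (C c x) * θ₂ (a x i)) *
          (∑ x, θ₁ (C c x) * θ₂ (a x i)) := by
        have hl : ∀ x : N, star (θ₂ x) * θ₂ 1 = star (θ₂ x) := fun x => by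
          rw [← map_star, apply_mul_one]
        have hr : ∀ x : N, θ₂ 1 * θ₂ x = θ₂ x := one_mul_apply θ₂
        have h3 : (star a * Z * a) i i = ∑ y, ∑ x, star (a x i) * Z x y * a y i := by
          simp only [CStarMatrix.mul_apply, CStarMatrix.star_apply, Finset.sum_mul]
        have h4 : ∀ x y, θ₂ (star (a x i) * Z x y * a y i) =
            ∑ c, star (θ₁ (C c x) * θ₂ (a x i)) * (θ₁ (C c y) * θ₂ (a y i)) := fun x y => by
          rw [map_mul, map_mul, hZ, apply_transfer, map_star, map_sum]
          calc star (θ₂ (a x i)) * (θ₂ 1 * (∑ c, θ₁ (star (C c x) * C c y)) * θ₂ 1) * θ₂ (a y i)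
              = star (θ₂ (a x i)) * θ₂ 1 * (∑ c, θ₁ (star (C c x) * C c y)) *
                (θ₂ 1 * θ₂ (a y i)) := by noncomm_ring
            _ = _ := by
              rw [hl, hr, Finset.mul_sum, Finset.sum_mul]
              refine Finset.sum_congr rfl fun c _ => ?_
              rw [map_mul, map_star, star_mul]
              noncomm_ring
        rw [h3]
        simp only [map_sum, h4]
        rw [Finset.sum_comm]
        simp only [star_sum, Finset.sum_mul, Finset.mul_sum]
        rw [Finset.sum_congr rfl fun x _ => Finset.sum_comm, Finset.sum_comm]
        exact Finset.sum_congr rfl fun _ _ => Finset.sum_comm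
      rw [e, map_sum, Complex.re_sum]
      exact Finset.sum_nonneg fun c _ => (Complex.nonneg_iff.mp (τ.nonneg _)).1
  obtain ⟨D, hD⟩ := exists_eq_star_mul_self hpos
  refine ⟨CStarMatrix.ofMatrix.symm D, ?_⟩
  ext i j
  have := congrArg (fun X : Mat n N => X i j) hD
  simp only [CStarMatrix.mul_apply, CStarMatrix.star_apply] at this
  rw [Matrix.mul_apply]
  exact this

end CPMap

end IsCornerEmbedding

end

/-! ### Completeness of von Neumann algebras in the trace norm -/

noncomputable section

open Filter Topology

/-- Bounded sequences of operators converge weakly along ultrafilters. -/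
theorem exists_weak_limit {H : Type*} [NormedAddCommGroup H] [InnerProductSpace ℂ H]
    [CompleteSpace H] (𝒰 : Ultrafilter ℕ) {x : ℕ → H →L[ℂ] H} {C : ℝ} (hC : ∀ n, ‖x n‖ ≤ C) :
    ∃ T : H →L[ℂ] H, ∀ ξ η, Tendsto (fun n => ⟪η, x n ξ⟫_ℂ) 𝒰 (𝓝 ⟪η, T ξ⟫_ℂ) := by
  have key : ∀ ξ : H, ∃ ζ : H, ‖ζ‖ ≤ C * ‖ξ‖ ∧
      ∀ η, Tendsto (fun n => ⟪η, x n ξ⟫_ℂ) 𝒰 (𝓝 ⟪η, ζ⟫_ℂ) := by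
    intro ξ
    -- Banach–Alaoglu for the bounded vectors `x n ξ`, viewed in the dual by the Riesz isomorphism.
    let φ : ℕ → WeakDual ℂ H := fun n => StrongDual.toWeakDual (InnerProductSpace.toDual ℂ H (x n ξ))
    have hcomp := WeakDual.isCompact_closedBall (𝕜 := ℂ) (E := H) 0 (C * ‖ξ‖)
    have hmem : ∀ n, φ n ∈ WeakDual.toStrongDual ⁻¹' Metric.closedBall (0 : StrongDual ℂ H) (C * ‖ξ‖) := by
      intro n
      rw [Set.mem_preimage, mem_closedBall_zero_iff]
      change ‖InnerProductSpace.toDual ℂ H (x n ξ)‖ ≤ _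
      rw [LinearIsometryEquiv.norm_map]
      exact ((x n).le_opNorm ξ).trans (by gcongr; exact hC n)
    obtain ⟨ψ, hψ, hlim⟩ := hcomp.ultrafilter_le_nhds (𝒰.map φ)
      (le_principal_iff.mpr (Ultrafilter.mem_map.mpr (Filter.Eventually.of_forall hmem)))
    refine ⟨(InnerProductSpace.toDual ℂ H).symm (WeakDual.toStrongDual ψ), ?_, fun η => ?_⟩
    · rw [LinearIsometryEquiv.norm_map]
      simpa using hψ
    · have h1 : Tendsto φ 𝒰 (𝓝 ψ) := hlim
      have h2 := (WeakDual.eval_continuous η).tendsto ψ |>.comp h1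
      have h3 := (Complex.continuous_conj.tendsto _).comp h2
      have e : (starRingEnd ℂ) (ψ η) =
          ⟪η, (InnerProductSpace.toDual ℂ H).symm (WeakDual.toStrongDual ψ)⟫_ℂ := by
        rw [← inner_conj_symm, InnerProductSpace.toDual_symm_apply]; rfl
      rw [← e]
      refine h3.congr fun n => ?_
      change (starRingEnd ℂ) ⟪x n ξ, η⟫_ℂ = _
      rw [inner_conj_symm]
  choose T hTn hT using key
  let L : H →ₗ[ℂ] H :=
    { toFun := T
      map_add' := fun ξ ξ' => ext_inner_left ℂ fun η => tendsto_nhds_unique (hT _ η) (by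
        simpa only [map_add, inner_add_right] using (hT ξ η).add (hT ξ' η))
      map_smul' := fun c ξ => ext_inner_left ℂ fun η => tendsto_nhds_unique (hT _ η) (by
        simpa only [map_smul, inner_smul_right, RingHom.id_apply] using (hT ξ η).const_mul c) }
  exact ⟨L.mkContinuous C hTn, hT⟩

theorem exists_one_sub_eq_star_mul_self {A : Type*} [CStarAlgebra A] [PartialOrder A]
    [StarOrderedRing A] {x : A} (hx : x ≤ 1) : ∃ d, 1 - x = star d * d :=
  IsCornerEmbedding.exists_eq_star_mul_self (sub_nonneg.mpr hx)

namespace VonNeumannAlgebra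

variable {H : Type*} [NormedAddCommGroup H] [InnerProductSpace ℂ H] [CompleteSpace H]
  (M : VonNeumannAlgebra H)

instance isClosed_toStarSubalgebra : IsClosed (M.toStarSubalgebra : Set (H →L[ℂ] H)) := by
  rw [coe_toStarSubalgebra, ← M.centralizer_centralizer]
  exact Set.isClosed_centralizer _

instance : CStarAlgebra M.Elem :=
  StarSubalgebra.cstarAlgebra (h_closed := M.isClosed_toStarSubalgebra) M.toStarSubalgebra

instance elemPartialOrder : PartialOrder M.Elem := CStarAlgebra.spectralOrder M.Elem

instance : StarOrderedRing M.Elem := CStarAlgebra.spectralOrderedRing M.Elem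

variable {M}

/-- A normal faithful tracial state as a faithful trace. -/
def IsTracialState.toTrace {τ : M.Elem →ₗ[ℂ] ℂ} (h : M.IsTracialState τ) : FaithfulTrace M.Elem where
  toLin := τ
  nonneg' := h.nonneg
  faithful' := h.faithful
  tracial' := h.tracial

theorem IsTracialState.toTrace_apply {τ : M.Elem →ₗ[ℂ] ℂ} (h : M.IsTracialState τ) (x : M.Elem) :
    h.toTrace x = τ x := rfl

theorem IsTracialState.twoNorm_eq {τ : M.Elem →ₗ[ℂ] ℂ} (h : M.IsTracialState τ) (x : M.Elem) :
    twoNorm τ x = ‖h.toTrace.toL2 x‖ := by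
  rw [twoNorm, ← Real.sqrt_sq (norm_nonneg (h.toTrace.toL2 x)), FaithfulTrace.norm_toL2_sq]
  rfl

/-- Dominated convergence in the series defining `τ`. Normality enters the proof only through this
lemma. -/
theorem IsNormal.tendsto_of_weak {τ : M.Elem →ₗ[ℂ] ℂ} (h : M.IsNormal τ) {𝒰 : Ultrafilter ℕ}
    {x : ℕ → M.Elem} {C : ℝ} (hC : ∀ n, ‖x n‖ ≤ C) {T : M.Elem}
    (hT : ∀ ξ η, Tendsto (fun n => ⟪η, (x n : H →L[ℂ] H) ξ⟫_ℂ) 𝒰 (𝓝 ⟪η, (T : H →L[ℂ] H) ξ⟫_ℂ))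
    (a : M.Elem) : Tendsto (fun n => τ (a * x n)) 𝒰 (𝓝 (τ (a * T))) := by
  obtain ⟨ξ, η, hξ, hη, hsum⟩ := h
  have e : ∀ y, τ (a * y) = ∑' k, ⟪η k, ((a * y : M.Elem) : H →L[ℂ] H) (ξ k)⟫_ℂ :=
    fun y => (hsum (a * y)).tsum_eq.symm
  simp only [e]
  refine tendsto_tsum_of_dominated_convergence
    (bound := fun k => ‖a‖ * C * (‖η k‖ ^ 2 + ‖ξ k‖ ^ 2)) ((hη.add hξ).mul_left _) (fun k => ?_)
    (Eventually.of_forall fun n k => ?_)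
  · have h1 := hT (ξ k) (ContinuousLinearMap.adjoint (a : H →L[ℂ] H) (η k))
    simp only [ContinuousLinearMap.adjoint_inner_left] at h1
    exact h1
  · have h1 : ‖((a * x n : M.Elem) : H →L[ℂ] H) (ξ k)‖ ≤ ‖a‖ * C * ‖ξ k‖ := by
      refine (ContinuousLinearMap.le_opNorm _ _).trans ?_
      refine mul_le_mul_of_nonneg_right ?_ (norm_nonneg _)
      exact (norm_mul_le a (x n)).trans (mul_le_mul_of_nonneg_left (hC n) (norm_nonneg a))
    have h0 : 0 ≤ ‖a‖ * C := mul_nonneg (norm_nonneg _) ((norm_nonneg _).trans (hC 0))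
    calc ‖⟪η k, ((a * x n : M.Elem) : H →L[ℂ] H) (ξ k)⟫_ℂ‖
        ≤ ‖η k‖ * ‖((a * x n : M.Elem) : H →L[ℂ] H) (ξ k)‖ := norm_inner_le_norm _ _
      _ ≤ ‖η k‖ * (‖a‖ * C * ‖ξ k‖) := by gcongr
      _ = ‖a‖ * C * (‖η k‖ * ‖ξ k‖) := by ring
      _ ≤ _ := by
        gcongr
        nlinarith [sq_nonneg (‖η k‖ - ‖ξ k‖), sq_nonneg ‖η k‖, sq_nonneg ‖ξ k‖]

/-- The unit ball of a von Neumann algebra is complete in the norm of a normal trace. -/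
theorem IsTracialState.complete {τ : M.Elem →ₗ[ℂ] ℂ} (h : M.IsTracialState τ) :
    h.toTrace.Complete := by
  rintro x ⟨C, hC⟩ hx
  obtain ⟨T, hT⟩ := exists_weak_limit (hyperfilter ℕ) (x := fun n => (x n : H →L[ℂ] H)) hC
  have hTM : T ∈ M := by
    rw [← M.commutant_commutant, mem_commutant_iff]
    intro y hy
    ext ξ
    refine ext_inner_left ℂ fun η => ?_
    have h1 := hT ξ (ContinuousLinearMap.adjoint y η)
    have h2 := hT (y ξ) η
    simp only [ContinuousLinearMap.adjoint_inner_left] at h1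
    refine tendsto_nhds_unique h1 (h2.congr fun n => ?_)
    have h3 := mem_commutant_iff.mp hy (x n) (x n).2
    exact congrArg (fun S : H →L[ℂ] H => ⟪η, S ξ⟫_ℂ) h3
  refine ⟨⟨T, hTM⟩, ?_⟩
  set T' : M.Elem := ⟨T, hTM⟩
  rw [Metric.tendsto_atTop]
  intro ε hε
  obtain ⟨N, hN⟩ := Metric.cauchySeq_iff.mp hx (ε / 2) (by positivity)
  refine ⟨N, fun n hn => ?_⟩
  rw [dist_eq_norm, ← map_sub]
  set d := x n - T'
  -- Cauchy–Schwarz bounds `τ(d*(xₙ - xₘ))` by `‖d‖₂ ε/2` for large `m`; in the weak limit this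
  -- bounds `‖d‖₂²`.
  have hlim : Tendsto (fun m => h.toTrace (star d * (x n - x m))) (hyperfilter ℕ)
      (𝓝 (h.toTrace (star d * d))) := by
    have h1 := h.normal.tendsto_of_weak hC (T := T') hT (star d)
    simp only [d, mul_sub, map_sub]
    exact tendsto_const_nhds.sub h1
  have hle : ‖h.toTrace.toL2 d‖ ^ 2 ≤ ‖h.toTrace.toL2 d‖ * (ε / 2) := by
    have h1 : ‖h.toTrace (star d * d)‖ = ‖h.toTrace.toL2 d‖ ^ 2 := by
      rw [FaithfulTrace.apply_star_mul_self, Complex.norm_real, Real.norm_of_nonneg (by positivity)]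
    rw [← h1]
    refine le_of_tendsto hlim.norm ?_
    have : ∀ᶠ m in (hyperfilter ℕ : Filter ℕ), N ≤ m :=
      Nat.hyperfilter_le_atTop (eventually_ge_atTop N)
    filter_upwards [this] with m hm
    have h2 := norm_inner_le_norm (𝕜 := ℂ) (h.toTrace.toL2 d) (h.toTrace.toL2 (x n - x m))
    rw [FaithfulTrace.inner_toL2] at h2
    refine h2.trans (mul_le_mul_of_nonneg_left ?_ (norm_nonneg _))
    have h3 := hN n hn m hm
    rw [dist_eq_norm, ← map_sub] at h3
    exact h3.le
  rcases (norm_nonneg (h.toTrace.toL2 d)).eq_or_lt with h0 | h0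
  · rw [← h0]; exact hε
  · nlinarith

theorem IsFactor.hasTrivialCenter (h : M.IsFactor) : HasTrivialCenter M.Elem := by
  intro z hz
  obtain ⟨c, hc⟩ := h z z.2 (mem_commutant_iff.mpr fun g hg =>
    (congrArg Subtype.val (hz ⟨g, hg⟩)).symm)
  exact ⟨c, Subtype.ext hc⟩

namespace Projection

variable (p : M.Projection)

/-- The inclusion of the corner `pMp` in `M`. -/
def incl : (M.corner p).Elem →⋆ₙₐ[ℂ] M.Elem where
  toFun T := ⟨p.extend T, T.2⟩
  map_smul' c T := Subtype.ext <| by ext v; simp [extend]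
  map_zero' := Subtype.ext <| by ext v; simp [extend]
  map_add' S T := Subtype.ext <| by ext v; simp [extend]
  map_mul' S T := Subtype.ext <| p.extend_mul _ _
  map_star' T := Subtype.ext <| p.extend_star _

theorem incl_one : p.incl 1 = p.elem := Subtype.ext p.extend_one

theorem incl_isCornerEmbedding : IsCornerEmbedding p.incl where
  injective := fun S T h => Subtype.ext <| by
    have := congrArg (fun x : M.Elem => p.compress x) h
    simpa [incl, p.compress_extend] using this
  exists_eq x := ⟨⟨p.compress x, (M.mem_corner_iff p _).mpr ⟨x, x.2, rfl⟩⟩, by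
    rw [incl_one]
    exact Subtype.ext (p.extend_compress _)⟩

theorem elem_isStarProjection : IsStarProjection p.elem where
  isIdempotentElem := Subtype.ext p.isStarProjection.isIdempotentElem
  isSelfAdjoint := Subtype.ext p.isStarProjection.isSelfAdjoint

theorem elem_ne_zero {p : M.Projection} (hp : p.op ≠ 0) : p.elem ≠ 0 :=
  fun h => hp (congrArg Subtype.val h)

end Projection

/-- Passes from the spectral order of `M` to the operator order on `H`, through `1 - x = d* d`. -/
theorem coe_le_one {x : M.Elem} (hx : (elemPartialOrder M).le x 1) : (x : H →L[ℂ] H) ≤ 1 := by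
  obtain ⟨d, hd⟩ := exists_one_sub_eq_star_mul_self hx
  have : (1 : H →L[ℂ] H) - x = star (d : H →L[ℂ] H) * d := congrArg Subtype.val hd
  rw [← sub_nonneg, this]
  exact star_mul_self_nonneg _

/-- A von Neumann subalgebra, as a star subalgebra of the elements of the larger algebra. -/
def restrict (B : VonNeumannAlgebra H) (M : VonNeumannAlgebra H) : StarSubalgebra ℂ M.Elem :=
  B.toStarSubalgebra.comap M.toStarSubalgebra.subtype

/-- `B` is itself a C⋆-algebra, so it is spanned by its own unitaries. -/
theorem mem_span_unitary_restrict {B : VonNeumannAlgebra H} (hBM : B ≤ M) {b : M.Elem}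
    (hb : b ∈ B.restrict M) :
    b ∈ Submodule.span ℂ {u : M.Elem | u ∈ B.restrict M ∧ u ∈ unitary M.Elem} := by
  let ι : B.Elem →⋆ₐ[ℂ] M.Elem := StarSubalgebra.inclusion hBM
  have h : ∀ y : B.Elem, ι y ∈
      Submodule.span ℂ {u : M.Elem | u ∈ B.restrict M ∧ u ∈ unitary M.Elem} := by
    intro y
    have hy : y ∈ Submodule.span ℂ (unitary B.Elem : Set B.Elem) := by
      rw [CStarAlgebra.span_unitary]; trivial
    induction hy using Submodule.span_induction with
    | mem u hu =>
      exact Submodule.subset_span ⟨u.2, Unitary.map_mem ι hu⟩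
    | zero => rw [map_zero]; exact Submodule.zero_mem _
    | add a b _ _ ha hb => rw [map_add]; exact Submodule.add_mem _ ha hb
    | smul r a _ ha => rw [map_smul]; exact Submodule.smul_mem _ _ ha
  exact h ⟨b, hb⟩

end VonNeumannAlgebra

end

/-! ### Separability, rigidity and countability -/

noncomputable section

open Filter Topology

/-- An uncountable family in a separable space has two members that are close to each other. -/
theorem exists_ne_dist_lt {α X : Type*} [PseudoMetricSpace X] [TopologicalSpace.SeparableSpace X]
    {S : Set α} (hS : ¬ S.Countable) (f : α → X) {ε : ℝ} (hε : 0 < ε) :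
    ∃ s ∈ S, ∃ t ∈ S, s ≠ t ∧ dist (f s) (f t) < ε := by
  by_contra! hcon
  have hne : S.Nonempty := Set.nonempty_iff_ne_empty.mpr fun h => hS (h ▸ Set.countable_empty)
  have : Nonempty X := ⟨f hne.some⟩
  have hd : ∀ a, ∃ n, dist (f a) (TopologicalSpace.denseSeq X n) < ε / 2 := fun a =>
    (TopologicalSpace.denseRange_denseSeq X).exists_dist_lt (f a) (half_pos hε)
  choose g hg using hd
  refine hS (Set.MapsTo.countable_of_injOn (Set.mapsTo_univ g S) (fun s hs t ht hst => ?_)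
    Set.countable_univ)
  by_contra hne
  refine (hcon s hs t ht hne).not_gt ((dist_triangle_right _ _ _).trans_lt
    ((add_lt_add (hg s) (hst ▸ hg t)).trans_eq (add_halves ε)))

namespace FaithfulTrace

theorem separableSpace_matrix {A : Type*} [CStarAlgebra A] [PartialOrder A] [StarOrderedRing A]
    (τ : FaithfulTrace A) [TopologicalSpace.SeparableSpace τ.L2] (k : ℕ) :
    TopologicalSpace.SeparableSpace (τ.matrix k).L2 := by
  let f : (Fin k → Fin k → τ.L2) →+ (τ.matrix k).L2 :=
    { toFun := fun X => (τ.matrix k).toL2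
        (CStarMatrix.ofMatrix (Matrix.of fun i j => τ.toL2.symm (X i j)))
      map_zero' := by
        rw [← map_zero (τ.matrix k).toL2]
        congr 1
      map_add' := fun X Y => by
        rw [← map_add (τ.matrix k).toL2]
        congr 1 }
  have hf : Continuous f := by
    refine AddMonoidHomClass.continuous_of_bound f (k * k) fun X => ?_
    refine (τ.norm_toL2_matrix_le _).trans ?_
    have h : ∀ i j : Fin k, ‖τ.toL2 (τ.toL2.symm (X j i))‖ ≤ ‖X‖ := fun i j => by
      rw [LinearEquiv.apply_symm_apply]
      exact (norm_le_pi_norm (X j) i).trans (norm_le_pi_norm X j)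
    refine (Finset.sum_le_sum fun i _ => Finset.sum_le_sum fun j _ => h i j).trans_eq ?_
    simp [mul_assoc]
  have hs : Function.Surjective f := fun Y => by
    refine ⟨fun i j => τ.toL2 ((τ.matrix k).toL2.symm Y i j), ?_⟩
    change (τ.matrix k).toL2 _ = Y
    rw [← LinearEquiv.eq_symm_apply]
    ext i j
    exact τ.toL2.symm_apply_apply _
  exact hs.denseRange.separableSpace hf

end FaithfulTrace

theorem IsCornerEmbedding.isStarProjection_one {N Q : Type*} [CStarAlgebra N] [CStarAlgebra Q]
    (ι : N →⋆ₙₐ[ℂ] Q) : IsStarProjection (ι 1) where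
  isIdempotentElem := by rw [IsIdempotentElem, ← map_mul, mul_one]
  isSelfAdjoint := by rw [isSelfAdjoint_iff, ← map_star ι, _root_.star_one]

/-- Isomorphic corners `N₁ ≅ N₂` give an embedding of any corner onto a corner of the matrices that
scales the trace. -/
theorem IsCornerEmbedding.exists_amplification {N N₁ N₂ A : Type*} [CStarAlgebra N]
    [CStarAlgebra N₁] [CStarAlgebra N₂] [CStarAlgebra A] [PartialOrder A] [StarOrderedRing A]
    {τ : FaithfulTrace A} (hτ : τ.Complete) (hA : HasTrivialCenter A) (hτ1 : τ 1 = 1)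
    {ι : N →⋆ₙₐ[ℂ] A} {ι₁ : N₁ →⋆ₙₐ[ℂ] A} {ι₂ : N₂ →⋆ₙₐ[ℂ] A} (hι : IsCornerEmbedding ι)
    (hι₁ : IsCornerEmbedding ι₁) (hι₂ : IsCornerEmbedding ι₂) (α : N₁ ≃⋆ₐ[ℂ] N₂) (h0 : ι₁ 1 ≠ 0) :
    ∃ (k : ℕ) (θ : N →⋆ₙₐ[ℂ] FaithfulTrace.Mat k A), IsCornerEmbedding θ ∧
      ∀ x, τ.matrix k (θ x) * τ (ι₁ 1) = τ (ι₂ 1) * τ (ι x) := by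
  obtain ⟨k, v, hv, hpv, hsum⟩ := hτ.exists_decomposition hA hτ1
    (isStarProjection_one ι) (isStarProjection_one ι₁) h0
  have hψ := hι₂.comp_equiv α
  refine ⟨k, amplify ι hι₁ _ v hv hsum, amplify_isCornerEmbedding hι hι₁ hψ v hv hpv hsum,
    fun x => ?_⟩
  rw [amplify_trace hι₁ hψ v hv hsum hτ hA x]
  change τ (ι₂ (α 1)) * _ = _
  rw [map_one]

namespace VonNeumannAlgebra

variable {H : Type*} [NormedAddCommGroup H] [InnerProductSpace ℂ H] [CompleteSpace H]

open IsCornerEmbedding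

theorem IsTracialState.separableSpace {M : VonNeumannAlgebra H} {τ : M.Elem →ₗ[ℂ] ℂ}
    (h : M.IsTracialState τ) {S : Set M.Elem} (hS : S.Countable)
    (hd : ∀ x : M.Elem, ∀ ε > 0, ∃ s ∈ S, twoNorm τ (x - s) < ε) :
    TopologicalSpace.SeparableSpace h.toTrace.L2 := by
  refine ⟨h.toTrace.toL2 '' S, hS.image _, Metric.dense_iff.mpr fun x r hr => ?_⟩
  obtain ⟨s, hs, hlt⟩ := hd (h.toTrace.toL2.symm x) r hr
  refine ⟨_, ?_, Set.mem_image_of_mem _ hs⟩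
  rwa [h.twoNorm_eq, map_sub, LinearEquiv.apply_symm_apply, ← dist_eq_norm, dist_comm] at hlt

theorem eq_of_close_of_rigid {B N : VonNeumannAlgebra H} {σ : N.Elem →ₗ[ℂ] ℂ}
    (hσ : N.IsTracialState σ) (hBN : B ≤ N) (hcomm : ∀ x ∈ N, x ∈ B.commutant → x ∈ B)
    {F : Finset N.Elem} {δ : ℝ}
    (hF : ∀ φ : N.Elem →ₗ[ℂ] N.Elem, IsCompletelyPositive φ → (φ 1 : H →L[ℂ] H) ≤ 1 →
      (∀ x : N.Elem, σ (φ (star x * x)) ≤ σ (star x * x)) →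
      (∀ x ∈ F, twoNorm σ (φ x - x) ≤ δ) →
      ∀ b : N.Elem, (b : H →L[ℂ] H) ∈ B → ‖(b : H →L[ℂ] H)‖ ≤ 1 → twoNorm σ (φ b - b) ≤ 1 / 2)
    {Q : Type*} [CStarAlgebra Q] {τ : FaithfulTrace Q} (hτ : τ.Complete)
    {θ₁ θ₂ : N.Elem →⋆ₙₐ[ℂ] Q} (hθ₁ : IsCornerEmbedding θ₁) (hθ₂ : IsCornerEmbedding θ₂)
    {t₁ t₂ c : ℝ} (hc : 0 < c) (hδ : 0 < δ) (h12 : t₁ ≤ t₂) (hc₂ : c ≤ t₂)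
    (h₁ : ∀ x, τ (θ₁ x) = t₁ * hσ.toTrace x) (h₂ : ∀ x, τ (θ₂ x) = t₂ * hσ.toTrace x)
    (hclose : ∀ x ∈ F, ‖τ.toL2 (θ₁ x - θ₂ x)‖ ≤ √c * δ)
    (hclose₁ : ‖τ.toL2 (θ₁ 1 - θ₂ 1)‖ ≤ √c / 8) : t₁ = t₂ := by
  have ht₂ : 0 < t₂ := hc.trans_le hc₂
  have hsc : √c ≤ √t₂ := Real.sqrt_le_sqrt hc₂
  have hs₂ : 0 < √t₂ := Real.sqrt_pos.mpr ht₂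
  have key := hF (transfer θ₁ hθ₂) (transfer_completelyPositive hθ₂ ht₂ h₂)
    (coe_le_one (transfer_one_le hθ₂ ht₂ h₂)) (apply_transfer_le hθ₂ ht₂ h12 h₁ h₂) (by
      intro x hx
      rw [hσ.twoNorm_eq]
      refine le_of_mul_le_mul_left ?_ hs₂
      exact (norm_toL2_transfer_sub_le hθ₂ ht₂ h₂ x).trans
        ((hclose x hx).trans (mul_le_mul_of_nonneg_right hsc hδ.le)))
  have h1 : ‖hσ.toTrace.toL2 1‖ = 1 := by
    rw [← hσ.twoNorm_eq, twoNorm, star_one, one_mul, hσ.map_one, Complex.one_re, Real.sqrt_one]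
  -- The bound is `√c/4 + √t₂/2 ≤ (3/4)√t₂`, strictly less than `‖θ₂(1)‖₂ = √t₂`.
  obtain ⟨v, hv0, hl, hr, hv⟩ := exists_intertwiner hτ (θ₁ := θ₁) (θ₂ := θ₂) (B.restrict N)
    (fun b hb => mem_span_unitary_restrict hBN hb) (c := 2 * (√c / 8) + √t₂ * (1 / 2))
    (fun u hu hu' => by
      have hu1 : ‖(u : H →L[ℂ] H)‖ ≤ 1 := by
        rcases subsingleton_or_nontrivial N.Elem with h | h
        · rw [Subsingleton.elim u 0]
          exact norm_zero.trans_le zero_le_one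
        · exact (CStarRing.norm_of_mem_unitary hu').le
      have := key u hu hu1
      rw [hσ.twoNorm_eq] at this
      refine (norm_toL2_sub_le hθ₂ ht₂ h₂ hu').trans ?_
      gcongr)
    (by
      rw [norm_toL2_scale ht₂.le h₂, h1]
      linarith)
  refine eq_of_exists_intertwiner hθ₁ hθ₂ h₁ h₂ (B.restrict N) (fun y hy => ?_) hv0 hl hr hv
  refine hcomm y y.2 (mem_commutant_iff.mpr fun b hb => ?_)
  exact congrArg Subtype.val (hy ⟨b, hBN hb⟩ hb)

theorem IsTracialState.re_apply_pos {M : VonNeumannAlgebra H} {τ : M.Elem →ₗ[ℂ] ℂ}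
    (h : M.IsTracialState τ) {p : M.Projection} (hp : p.op ≠ 0) :
    0 < (τ p.elem).re ∧ τ p.elem = (τ p.elem).re := by
  have h2 : star p.elem * p.elem = p.elem := by
    rw [p.elem_isStarProjection.isSelfAdjoint.star_eq, p.elem_isStarProjection.isIdempotentElem.eq]
  have h0 := h.nonneg p.elem
  rw [h2] at h0
  have h3 : τ p.elem = (τ p.elem).re := Complex.eq_re_of_ofReal_le h0
  refine ⟨lt_of_le_of_ne (Complex.nonneg_iff.mp h0).1 fun h4 => ?_, h3⟩
  refine Projection.elem_ne_zero hp (h.faithful _ ?_)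
  rw [h2, h3, ← h4, Complex.ofReal_zero]

/-- An element `t` of the fundamental group of a II₁ factor gives an embedding of any corner onto a
corner of the matrices over the factor that scales the trace by `t`. -/
theorem exists_embedding_of_mem_fundamentalGroup {M : VonNeumannAlgebra H} (hM : M.IsFactor)
    {τ : M.Elem →ₗ[ℂ] ℂ} (hτ : M.IsTracialState τ) (p : M.Projection) {t : ℝ}
    (ht : t ∈ M.fundamentalGroup) :
    0 < t ∧ ∃ (k : ℕ) (θ : (M.corner p).Elem →⋆ₙₐ[ℂ] FaithfulTrace.Mat k M.Elem),
      IsCornerEmbedding θ ∧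
      ∀ x, hτ.toTrace.matrix k (θ x) = t * hτ.toTrace (p.incl x) := by
  obtain ⟨τ', hτ', e, f, he, hf, ⟨α⟩, rfl⟩ := ht
  have hA := hM.hasTrivialCenter
  -- The trace in the definition of the fundamental group need not be the given one a priori;
  -- uniqueness identifies them.
  have hττ' : ∀ x, τ' x = τ x := fun x => by
    have := hτ.complete.apply_mul_apply_one hA hτ'.complete x
    simpa only [IsTracialState.toTrace_apply, hτ.map_one, hτ'.map_one, mul_one] using this
  rw [hττ', hττ']
  obtain ⟨hepos, hee⟩ := hτ.re_apply_pos he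
  obtain ⟨hfpos, hff⟩ := hτ.re_apply_pos hf
  refine ⟨div_pos hepos hfpos, ?_⟩
  -- The isomorphism is used from `fMf` to `eMe`, so that the scale is `τ(e)/τ(f)` and not its
  -- inverse.
  obtain ⟨k, θ, hθ, h⟩ := exists_amplification hτ.complete hA hτ.map_one
    p.incl_isCornerEmbedding f.incl_isCornerEmbedding e.incl_isCornerEmbedding α.symm
    (f.incl_one ▸ Projection.elem_ne_zero hf)
  refine ⟨k, θ, hθ, fun x => ?_⟩
  have h := h x
  rw [e.incl_one, f.incl_one, hτ.toTrace_apply, hτ.toTrace_apply, hee, hff] at h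
  have hf0 : ((τ f.elem).re : ℂ) ≠ 0 := Complex.ofReal_ne_zero.mpr hfpos.ne'
  rw [Complex.ofReal_div, div_mul_eq_mul_div, eq_div_iff hf0]
  exact h

end VonNeumannAlgebra

open VonNeumannAlgebra in
theorem theoremA1 {H : Type*} [NormedAddCommGroup H] [InnerProductSpace ℂ H] [CompleteSpace H]
    (M : VonNeumannAlgebra H) (hM : M.IsII1Factor) (hsep : M.IsSeparableTracial)
    (p : M.Projection) (hp : p.op ≠ 0)
    (B : VonNeumannAlgebra p.space)
    (hrigid : VonNeumannAlgebra.IsRigidInclusion B (M.corner p))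
    (hcomm : ∀ x ∈ M.corner p, x ∈ B.commutant → x ∈ B) :
    M.fundamentalGroup.Countable := by
  obtain ⟨τ, hτ, S, hS, hSd⟩ := hsep
  obtain ⟨hBN, σ, hσ, hrig⟩ := hrigid
  obtain ⟨F, δ, hδ, hF⟩ := hrig (1 / 2) (by norm_num)
  have hA := hM.factor.hasTrivialCenter
  have : TopologicalSpace.SeparableSpace hτ.toTrace.L2 := hτ.separableSpace hS hSd
  obtain ⟨hppos, hpp⟩ := hτ.re_apply_pos hp
  set r := (τ p.elem).re
  have hσp : ∀ x, hτ.toTrace (p.incl x) = r * hσ.toTrace x := fun x => by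
    have h := p.incl_isCornerEmbedding.apply_mul_apply_one hτ.complete hA hσ.complete x
    rw [p.incl_one, hτ.toTrace_apply p.elem, hpp, hσ.toTrace_apply 1, hσ.map_one, mul_one] at h
    rw [← h, mul_comm]
  -- Fixing `k` puts all embeddings in one separable space; the lower bound on the scale makes a
  -- single tolerance work for all of them.
  let T : ℕ → ℕ → Set ℝ := fun k m => {t | ((m : ℝ) + 1)⁻¹ ≤ t * r ∧
    ∃ θ : (M.corner p).Elem →⋆ₙₐ[ℂ] FaithfulTrace.Mat k M.Elem, IsCornerEmbedding θ ∧
      ∀ x, hτ.toTrace.matrix k (θ x) = (t * r : ℝ) * hσ.toTrace x}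
  have hcover : M.fundamentalGroup ⊆ ⋃ k, ⋃ m, T k m := by
    intro t ht
    obtain ⟨htpos, k, θ, hθ, hθt⟩ := exists_embedding_of_mem_fundamentalGroup hM.factor hτ p ht
    obtain ⟨m, hm⟩ := exists_nat_one_div_lt (mul_pos htpos hppos)
    refine Set.mem_iUnion₂.mpr ⟨k, m, (one_div ((m : ℝ) + 1) ▸ hm).le, θ, hθ, fun x => ?_⟩
    rw [hθt, hσp, Complex.ofReal_mul, mul_assoc]
  refine Set.Countable.mono hcover (Set.countable_iUnion fun k => Set.countable_iUnion fun m => ?_)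
  by_contra hunc
  have hT : ∀ t : T k m, ∃ θ : (M.corner p).Elem →⋆ₙₐ[ℂ] FaithfulTrace.Mat k M.Elem,
      IsCornerEmbedding θ ∧
      ∀ x, hτ.toTrace.matrix k (θ x) = (t * r : ℝ) * hσ.toTrace x := fun t => t.2.2
  choose θ hθ hθt using hT
  set c : ℝ := ((m : ℝ) + 1)⁻¹
  have hc : 0 < c := by positivity
  have hsc : 0 < √c := Real.sqrt_pos.mpr hc
  classical
  have := hτ.toTrace.separableSpace_matrix k
  -- Each `t` is sent to the tuple of values of `θ t` on `F ∪ {1}`; the point `1` controls the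
  -- distance between the two corner projections.
  obtain ⟨s, -, t, -, hst, hd⟩ := exists_ne_dist_lt (S := (Set.univ : Set (T k m)))
    (fun h => hunc (Set.countable_univ_iff.mp h))
    (fun t (x : (insert 1 F : Finset _)) => (hτ.toTrace.matrix k).toL2 (θ t x))
    (lt_min (mul_pos hsc hδ) (div_pos hsc (by norm_num : (0 : ℝ) < 8)))
  have hclose : ∀ x ∈ insert 1 F, ‖(hτ.toTrace.matrix k).toL2 (θ s x - θ t x)‖ ≤
      min (√c * δ) (√c / 8) := fun x hx => by
    rw [map_sub, ← dist_eq_norm]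
    exact (dist_le_pi_dist _ _ (⟨x, hx⟩ : (insert 1 F : Finset _))).trans hd.le
  refine hst (Subtype.ext (mul_right_cancel₀ hppos.ne' ?_))
  have main : ∀ s t : T k m, (∀ x ∈ insert 1 F,
      ‖(hτ.toTrace.matrix k).toL2 (θ s x - θ t x)‖ ≤ min (√c * δ) (√c / 8)) →
      (s : ℝ) * r ≤ t * r → (s : ℝ) * r = t * r := fun s t hclose hle =>
    eq_of_close_of_rigid hσ hBN hcomm hF (hτ.complete.matrix k) (hθ s) (hθ t) hc hδ hle t.2.1
      (hθt s) (hθt t)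
      (fun x hx => (hclose x (Finset.mem_insert_of_mem hx)).trans (min_le_left _ _))
      ((hclose 1 (Finset.mem_insert_self _ _)).trans (min_le_right _ _))
  -- The embedding of smaller scale must play the role of `θ₁`, for the transfer map to be
  -- subtracial.
  rcases le_total ((s : ℝ) * r) (t * r) with hle | hle
  · exact main s t hclose hle
  · refine (main t s (fun x hx => ?_) hle).symm
    rw [← neg_sub, map_neg, norm_neg]
    exact hclose x hx

end
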